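/- Let $m,c,\alpha>0$ and consider the relativistic Kepler problem $$\frac{d}{dt}\left(\frac{m\dot x}{\sqrt{1-|\dot x|^2/c^2}}\right)=-\alpha\,\frac{x}{|x|^3},\qquad x\in\mathbb R^2\setminus\{0\},\quad |\dot x|<c. \qquad (*)$$ For $T>0$ and an integer $k\ge 1$ let $\Lambda_k$ be the set of Lipschitz continuous $T$-periodic loops $x=(x_u,x_v):\mathbb R\to\mathbb R^2\setminus\{0\}$ with winding number $$\frac1{2\pi}\int_0^T\frac{x_u\dot x_v-x_v\dot x_u}{x_u^2+x_v^2}\,dt=k .$$ A solution $x$ of $(*)$ is called circular if $|x|$ is constant. For $k\ge2$ and $n\in\{1,\dots,k-1\}$, a non-circular $T$-periodic solution $x$ of $(*)$ is said to be of type $(n,k)$ if $x\in\Lambda_k$ and $|x|$ has minimal period $T/n$. Two solutions are identified if one is obtained from the other by a time translation and a rotation of the plane around the origin. Put $$T_*=\frac{2\pi\alpha}{mc^3},\qquad u^k_n=\frac{nk^3}{(k^2-n^2)^{3/2}}\,T_*\ \ (0\le n\le k-1),\qquad u^k_k=+\infty .$$ (a) Let $T>0$, $k\ge 2$ and $i_T\in\{0,\dots,k-1\}$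 be such that $u^k_{i_T}<T\le u^k_{i_T+1}$. If $i_T=0$, then $(*)$ has no non-circular $T$-periodic solution in $\Lambda_k$. If $i_T>0$, then, up to time translations and rotations, $(*)$ has exactly $i_T$ non-circular $T$-periodic solutions in $\Lambda_k$, and they are of types $(1,k),\dots,(i_T,k)$ (exactly one of each type). (b) For every $T>0$, $(*)$ has no non-circular $T$-periodic solution in $\Lambda_1$. -/

import Mathlib

open Set

noncomputable section

namespace RelKepler

/- The plane `ℝ²` is identified with `ℂ`: `x = x.re + i x.im`, and `‖x‖` is the Euclidean norm. -/

/-- The relativistic momentum `m v / √(1 - |v|² / c²)` of a particle of mass `m` and velocity `v`. -/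
def momentum (m c : ℝ) (v : ℂ) : ℂ := (m / √(1 - ‖v‖ ^ 2 / c ^ 2)) • v

/-- `x : ℝ → ℂ` is a (global, classical) solution of the relativistic Kepler problem
`d/dt (m x' / √(1 - |x'|² / c²)) = - α x / |x|³`, `x ∈ ℝ² \ {0}`. -/
structure IsSolution (m c α : ℝ) (x : ℝ → ℂ) : Prop where
  ne_zero : ∀ t, x t ≠ 0
  differentiable : Differentiable ℝ x
  speed_lt : ∀ t, ‖deriv x t‖ < c
  equation : ∀ t,
    HasDerivAt (fun s => momentum m c (deriv x s)) (-((α / ‖x t‖ ^ 3) • x t)) t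

/-- The winding number around the origin, as a line integral:
`(1 / 2π) ∫₀ᵀ (x_u x_v' - x_v x_u') / (x_u² + x_v²) dt` where `x = (x_u, x_v)`. -/
def windingNumber (T : ℝ) (x : ℝ → ℂ) : ℝ :=
  1 / (2 * Real.pi) *
    ∫ t in (0 : ℝ)..T,
      ((x t).re * (deriv x t).im - (x t).im * (deriv x t).re) / ((x t).re ^ 2 + (x t).im ^ 2)

/-- The set `Λ_k` of the Lipschitz continuous `T`-periodic loops in the plane that avoid the origin
and have winding number `k` around it. -/
def loops (T : ℝ) (k : ℤ) : Set (ℝ → ℂ) :=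
  {x | (∃ K, LipschitzWith K x) ∧ Function.Periodic x T ∧ (∀ t, x t ≠ 0) ∧
    windingNumber T x = k}

/-- `x` is circular: it moves on a circle centered at the origin. -/
def IsCircular (x : ℝ → ℂ) : Prop := ∃ R : ℝ, ∀ t, ‖x t‖ = R

/-- `τ` is the minimal period of `f`. -/
def IsMinimalPeriod (f : ℝ → ℝ) (τ : ℝ) : Prop :=
  IsLeast {σ : ℝ | 0 < σ ∧ Function.Periodic f σ} τ

/-- The set of the non-circular `T`-periodic solutions that belong to `Λ_k`. -/
def nonCircular (m c α T : ℝ) (k : ℤ) : Set (ℝ → ℂ) :=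
  {x | IsSolution m c α x ∧ x ∈ loops T k ∧ ¬ IsCircular x}

/-- `x` is a (non-circular, `T`-periodic) solution of type `(n, k)`. -/
def IsOfType (m c α T : ℝ) (n k : ℕ) (x : ℝ → ℂ) : Prop :=
  2 ≤ k ∧ n ∈ Icc 1 (k - 1) ∧ x ∈ nonCircular m c α T k ∧
    IsMinimalPeriod (fun t => ‖x t‖) (T / n)

/-- The threshold `T_* = 2πα / (m c³)`. -/
def Tstar (m c α : ℝ) : ℝ := 2 * Real.pi * α / (m * c ^ 3)

/-- The value `u^k_n = n k³ / (k² - n²)^{3/2} · T_*` for `n < k`, and `u^k_k = +∞`. -/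
def threshold (m c α : ℝ) (k n : ℕ) : EReal :=
  if n < k then
    (((n : ℝ) * (k : ℝ) ^ 3 / ((k : ℝ) ^ 2 - (n : ℝ) ^ 2) ^ (3 / 2 : ℝ) * Tstar m c α : ℝ) : EReal)
  else ⊤

/-- Two curves are equivalent if one is obtained from the other by a time translation and a
rotation of the plane around the origin. -/
def motionSetoid : Setoid (ℝ → ℂ) where
  r x y := ∃ s φ : ℝ, ∀ t, y t = Complex.exp (φ * Complex.I) * x (t + s)
  iseqv :=
    { refl := fun x => ⟨0, 0, fun t => by simp⟩
      symm := by
        rintro x y ⟨s, φ, h⟩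
        refine ⟨-s, -φ, fun t => ?_⟩
        rw [h, ← mul_assoc, ← Complex.exp_add]
        simp
      trans := by
        rintro x y z ⟨s, φ, h⟩ ⟨s', φ', h'⟩
        refine ⟨s' + s, φ' + φ, fun t => ?_⟩
        rw [h', h, ← mul_assoc, ← Complex.exp_add, add_assoc]
        push_cast
        ring_nf }

end RelKepler

end

/-!
Why the theorem is true. Along a solution, the angular momentum `L` and the energy
`H = c² M - α / |x|` are conserved, where `M = m γ` is the relativistic mass. A positive winding
number forces `L > 0`, so the polar angle `θ` is strictly increasing, and, as a function of `θ`, the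
inverse radius `u = 1 / |x|` solves the linear equation `u'' + κ² u = α H / (c² L²)` with
`κ² = 1 - α² / (c² L²)` (Binet's equation with a relativistic correction). If the coefficient
is nonpositive, periodic solutions are constant (`const_of_nonpos`). Otherwise
`u = A (1 + e cos κ(θ - θ₀))` (`eq_cos_of_pos`), a rosette; since `T`-periodicity adds `2πk` to `θ`,
non-circularity yields `κ = n / k` with an integer `1 ≤ n < k`. The constants `L`, `H`, `A` are
functions of `κ` and `e` (`eq_parameters`).

The time law of a rosette is explicit: Kepler's equation, written in the true anomaly, is an
antiderivative of `dt / dθ` (`clock`), and its increment over one radial oscillation is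
`T_* ((1 - e² (1 - κ²)) / ((1 - e²) (1 - κ²)))^{3/2}` (`Admissible.clock_add`). The inverse function
of `clock` gives the polar angle as a function of time, hence both the existence of the rosettes
(`isOfType_orbit`) and the fact that a solution is determined, up to motions, by `κ` and `e`
(`exists_orbit_of_mem_nonCircular`).

The radial period is injective in `e` and takes exactly the values above
`T_* / (1 - κ²)^{3/2}` for `0 < e < 1`. For `κ = n / k` this bound is `u^k_n / n`, so that
the equation `n · (radial period) = T` has exactly one solution `e` if `T > u^k_n` and none
otherwise. Since `u^k_n` increases with `n`, the types that occur are `(1, k), …, (i_T, k)`.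
-/

/-! ### Rosette orbits: parameters and the time law -/

namespace RelKepler

/-- Admissible parameters of a rosette orbit: physical constants `m, c, α`, ratio `κ` of the radial
to the angular frequency, eccentricity `e`. -/
structure Admissible (m c α κ e : ℝ) : Prop where
  m_pos : 0 < m
  c_pos : 0 < c
  α_pos : 0 < α
  κ_pos : 0 < κ
  κ_lt : κ < 1
  e_pos : 0 < e
  e_lt : e < 1

/-- The angular momentum of the rosette orbits with frequency ratio `κ`. -/
noncomputable def angMom (c α κ : ℝ) : ℝ := α / (c * √(1 - κ ^ 2))

/-- The energy (rest energy included) of the rosette orbit with parameters `κ`, `e`. -/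
noncomputable def energy (m c κ e : ℝ) : ℝ := m * c ^ 2 * κ / √(1 - e ^ 2 * (1 - κ ^ 2))

/-- The mean value, over the angle, of the inverse radius of the rosette orbit. -/
noncomputable def meanInvRadius (m c α κ e : ℝ) : ℝ := energy m c κ e * (1 - κ ^ 2) / (α * κ ^ 2)

/-- The inverse radius of the rosette orbit as a function of the polar angle `φ`. -/
noncomputable def invRadius (m c α κ e φ : ℝ) : ℝ :=
  meanInvRadius m c α κ e * (1 + e * Real.cos (κ * φ))

/-- The eccentric anomaly as a function of the true anomaly `f`, in the form that is smooth on the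
whole real line: `f - 2 arctan (β sin f / (1 + β cos f))`, where `β = e / (1 + √(1 - e²))` is the
solution of `2 β / (1 + β²) = e` in `[0, 1)`. -/
noncomputable def eccAnomaly (e f : ℝ) : ℝ :=
  f - 2 * Real.arctan (e / (1 + √(1 - e ^ 2)) * Real.sin f /
    (1 + e / (1 + √(1 - e ^ 2)) * Real.cos f))

/-- The time at which the rosette orbit passes the polar angle `φ`, when it passes the angle `0`
at time `0`: Kepler's equation, written in terms of the true anomaly `κ φ`. -/
noncomputable def clock (m c α κ e φ : ℝ) : ℝ :=
  1 / κ * (energy m c κ e / (c ^ 2 * angMom c α κ * meanInvRadius m c α κ e ^ 2) *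
      (1 / (1 - e ^ 2) * (eccAnomaly e (κ * φ) / √(1 - e ^ 2) -
        e * (Real.sin (κ * φ) / (1 + e * Real.cos (κ * φ))))) +
    α / (c ^ 2 * angMom c α κ * meanInvRadius m c α κ e) *
      (eccAnomaly e (κ * φ) / √(1 - e ^ 2)))

/-- The radial period of the rosette orbit, that is, the time between two passages of the
pericenter, see `Admissible.clock_add`. -/
noncomputable def radialPeriod (m c α κ e : ℝ) : ℝ :=
  Tstar m c α * (√(1 - e ^ 2 * (1 - κ ^ 2)) / (√(1 - e ^ 2) * √(1 - κ ^ 2))) ^ 3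

lemma one_add_mul_cos_pos {e : ℝ} (he : 0 ≤ e) (he1 : e < 1) (f : ℝ) :
    0 < 1 + e * Real.cos f := by
  nlinarith [Real.neg_one_le_cos f]

lemma hasDerivAt_eccAnomaly {e : ℝ} (he : 0 ≤ e) (he1 : e < 1) (f : ℝ) :
    HasDerivAt (eccAnomaly e) (√(1 - e ^ 2) / (1 + e * Real.cos f)) f := by
  have hη2 : √(1 - e ^ 2) ^ 2 = 1 - e ^ 2 := Real.sq_sqrt (by nlinarith)
  have hη0 : 0 ≤ √(1 - e ^ 2) := Real.sqrt_nonneg _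
  have hpos := one_add_mul_cos_pos he he1 f
  unfold eccAnomaly
  set η := √(1 - e ^ 2) with hη
  have hβ0 : 0 ≤ e / (1 + η) := by positivity
  have hβ1 : e / (1 + η) < 1 := by rw [div_lt_one (by positivity)]; linarith
  have hβη : e / (1 + η) * (1 + η) = e := by field_simp
  set β := e / (1 + η) with hβ
  have hpos' := one_add_mul_cos_pos hβ0 hβ1 f
  have h1 : HasDerivAt (fun f => β * Real.sin f / (1 + β * Real.cos f))
      ((β * Real.cos f * (1 + β * Real.cos f) - β * Real.sin f * (β * -Real.sin f)) /
        (1 + β * Real.cos f) ^ 2) f :=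
    ((Real.hasDerivAt_sin f).const_mul β).div
      (((Real.hasDerivAt_cos f).const_mul β).const_add 1) hpos'.ne'
  have h2 := (hasDerivAt_id f).sub ((h1.arctan).const_mul 2)
  refine h2.congr_deriv ?_
  have hs : Real.sin f ^ 2 = 1 - Real.cos f ^ 2 := by
    have := Real.sin_sq_add_cos_sq f; linarith
  have hden : 0 < (1 + β * Real.cos f) ^ 2 + (β * Real.sin f) ^ 2 := by positivity
  have e1 : (1 + (β * Real.sin f / (1 + β * Real.cos f)) ^ 2) =
      ((1 + β * Real.cos f) ^ 2 + (β * Real.sin f) ^ 2) / (1 + β * Real.cos f) ^ 2 := by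
    field_simp
  rw [e1]
  have hden' : (1 + β * Real.cos f) ^ 2 + (β * Real.sin f) ^ 2 =
      1 + β ^ 2 + 2 * β * Real.cos f := by rw [mul_pow, hs]; ring
  rw [hden'] at hden ⊢
  have hb2 : 1 + β ^ 2 = 2 / (1 + η) := by
    have : (1 + η) ^ 2 * (1 + β ^ 2) = (1 + η) * 2 := by
      linear_combination (β * (1 + η) + e) * hβη + hη2
    field_simp
    nlinarith
  have hkey : (1 - β ^ 2) * (1 + e * Real.cos f) = η * (1 + β ^ 2 + 2 * β * Real.cos f) := by
    have h1 : e * (1 + β ^ 2) = 2 * β := by rw [hb2, hβ]; ring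
    have h2 : 1 - β ^ 2 = η * (1 + β ^ 2) := by
      have : 1 - β ^ 2 = 2 - 2 / (1 + η) := by linarith
      rw [this, hb2]; field_simp; ring
    rw [h2]; linear_combination η * Real.cos f * h1
  clear_value β η
  rw [eq_div_iff hpos.ne']
  field_simp
  rw [hs]
  linear_combination hkey

lemma eccAnomaly_add_two_pi (e f : ℝ) :
    eccAnomaly e (f + 2 * Real.pi) = eccAnomaly e f + 2 * Real.pi := by
  unfold eccAnomaly
  rw [Real.sin_add_two_pi, Real.cos_add_two_pi]
  ring

lemma hasDerivAt_sin_div_one_add_mul_cos {e : ℝ} (he : 0 ≤ e) (he1 : e < 1) (f : ℝ) :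
    HasDerivAt (fun f => Real.sin f / (1 + e * Real.cos f))
      ((Real.cos f + e) / (1 + e * Real.cos f) ^ 2) f := by
  have hpos := one_add_mul_cos_pos he he1 f
  refine ((Real.hasDerivAt_sin f).div
    (((Real.hasDerivAt_cos f).const_mul e).const_add 1) hpos.ne').congr_deriv ?_
  congr 1
  linear_combination e * Real.sin_sq_add_cos_sq f

namespace Admissible

variable {m c α κ e : ℝ}

lemma one_sub_κ_sq_pos (h : Admissible m c α κ e) : 0 < 1 - κ ^ 2 := by
  nlinarith [h.κ_pos, h.κ_lt]

lemma one_sub_e_sq_pos (h : Admissible m c α κ e) : 0 < 1 - e ^ 2 := by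
  nlinarith [h.e_pos, h.e_lt]

lemma discr_pos (h : Admissible m c α κ e) : 0 < 1 - e ^ 2 * (1 - κ ^ 2) := by
  nlinarith [h.one_sub_e_sq_pos, h.one_sub_κ_sq_pos, mul_pos (pow_pos h.e_pos 2) (pow_pos h.κ_pos 2)]

lemma angMom_pos (h : Admissible m c α κ e) : 0 < angMom c α κ :=
  div_pos h.α_pos (mul_pos h.c_pos (Real.sqrt_pos.2 h.one_sub_κ_sq_pos))

lemma energy_pos (h : Admissible m c α κ e) : 0 < energy m c κ e :=
  div_pos (mul_pos (mul_pos h.m_pos (pow_pos h.c_pos 2)) h.κ_pos) (Real.sqrt_pos.2 h.discr_pos)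

lemma meanInvRadius_pos (h : Admissible m c α κ e) : 0 < meanInvRadius m c α κ e :=
  div_pos (mul_pos h.energy_pos h.one_sub_κ_sq_pos) (mul_pos h.α_pos (pow_pos h.κ_pos 2))

lemma invRadius_pos (h : Admissible m c α κ e) (φ : ℝ) : 0 < invRadius m c α κ e φ :=
  mul_pos h.meanInvRadius_pos (one_add_mul_cos_pos h.e_pos.le h.e_lt _)

lemma angMom_sq (h : Admissible m c α κ e) :
    angMom c α κ ^ 2 = α ^ 2 / (c ^ 2 * (1 - κ ^ 2)) := by
  unfold angMom
  rw [div_pow, mul_pow, Real.sq_sqrt h.one_sub_κ_sq_pos.le]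

lemma energy_sq (h : Admissible m c α κ e) :
    energy m c κ e ^ 2 = m ^ 2 * c ^ 4 * κ ^ 2 / (1 - e ^ 2 * (1 - κ ^ 2)) := by
  unfold energy
  rw [div_pow, Real.sq_sqrt h.discr_pos.le]
  ring

/-- The inverse radius solves the linear equation `U'' + U = α (H + α U) / (c² L²)` (Binet). -/
lemma binet (h : Admissible m c α κ e) (φ : ℝ) :
    invRadius m c α κ e φ -
        κ ^ 2 * (invRadius m c α κ e φ - meanInvRadius m c α κ e) =
      α * (energy m c κ e + α * invRadius m c α κ e φ) / (c ^ 2 * angMom c α κ ^ 2) := by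
  have := h.c_pos; have := h.α_pos; have := h.κ_pos; have := h.one_sub_κ_sq_pos
  rw [h.angMom_sq]
  have hH : energy m c κ e = meanInvRadius m c α κ e * (α * κ ^ 2) / (1 - κ ^ 2) := by
    unfold meanInvRadius; field_simp
  rw [hH]
  field_simp
  ring

/-- The energy relation `(H + α U)² = m² c⁴ + c² L² (U'² + U²)`. -/
lemma energy_relation (h : Admissible m c α κ e) (φ : ℝ) :
    (energy m c κ e + α * invRadius m c α κ e φ) ^ 2 = m ^ 2 * c ^ 4 + c ^ 2 * angMom c α κ ^ 2 *
      ((meanInvRadius m c α κ e * (e * (κ * Real.sin (κ * φ)))) ^ 2 +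
        invRadius m c α κ e φ ^ 2) := by
  have := h.c_pos; have := h.α_pos; have := h.κ_pos; have := h.one_sub_κ_sq_pos
  have hd := h.discr_pos
  have hm : m ^ 2 * c ^ 4 = energy m c κ e ^ 2 * (1 - e ^ 2 * (1 - κ ^ 2)) / κ ^ 2 := by
    rw [h.energy_sq]; field_simp
  have hH : energy m c κ e = meanInvRadius m c α κ e * (α * κ ^ 2) / (1 - κ ^ 2) := by
    unfold meanInvRadius; field_simp
  have hs : Real.sin (κ * φ) ^ 2 = 1 - Real.cos (κ * φ) ^ 2 := by
    have := Real.sin_sq_add_cos_sq (κ * φ); linarith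
  rw [h.angMom_sq, hm, hH]
  unfold invRadius
  simp only [mul_pow, hs]
  field_simp
  ring

lemma hasDerivAt_invRadius (m c α κ e φ : ℝ) :
    HasDerivAt (invRadius m c α κ e)
      (-(meanInvRadius m c α κ e * (e * (κ * Real.sin (κ * φ))))) φ := by
  have h1 : HasDerivAt (fun φ : ℝ => κ * φ) κ φ := by
    simpa using (hasDerivAt_id φ).const_mul κ
  have h2 := (((h1.cos).const_mul e).const_add 1).const_mul (meanInvRadius m c α κ e)
  exact h2.congr_deriv (by ring)

lemma hasDerivAt_clock (h : Admissible m c α κ e) (φ : ℝ) :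
    HasDerivAt (clock m c α κ e) ((energy m c κ e + α * invRadius m c α κ e φ) /
      (c ^ 2 * angMom c α κ * invRadius m c α κ e φ ^ 2)) φ := by
  have h1 : HasDerivAt (fun φ : ℝ => κ * φ) κ φ := by
    simpa using (hasDerivAt_id φ).const_mul κ
  have hE : HasDerivAt (fun φ : ℝ => eccAnomaly e (κ * φ)) _ φ :=
    (hasDerivAt_eccAnomaly h.e_pos.le h.e_lt (κ * φ)).comp φ h1
  have hS : HasDerivAt (fun φ : ℝ => Real.sin (κ * φ) / (1 + e * Real.cos (κ * φ))) _ φ :=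
    (hasDerivAt_sin_div_one_add_mul_cos h.e_pos.le h.e_lt (κ * φ)).comp φ h1
  have h2 := (((((hE.div_const √(1 - e ^ 2)).sub (hS.const_mul e)).const_mul
    (1 / (1 - e ^ 2))).const_mul
      (energy m c κ e / (c ^ 2 * angMom c α κ * meanInvRadius m c α κ e ^ 2))).add
        ((hE.div_const √(1 - e ^ 2)).const_mul
          (α / (c ^ 2 * angMom c α κ * meanInvRadius m c α κ e)))).const_mul (1 / κ)
  refine h2.congr_deriv ?_
  have hη := Real.sqrt_pos.2 h.one_sub_e_sq_pos
  have hd := one_add_mul_cos_pos h.e_pos.le h.e_lt (κ * φ)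
  have := h.c_pos; have := h.α_pos; have := h.κ_pos; have := h.one_sub_e_sq_pos
  have := h.angMom_pos; have := h.meanInvRadius_pos
  unfold invRadius
  field_simp
  ring

lemma clock_deriv_pos (h : Admissible m c α κ e) (φ : ℝ) :
    0 < (energy m c κ e + α * invRadius m c α κ e φ) /
      (c ^ 2 * angMom c α κ * invRadius m c α κ e φ ^ 2) := by
  have := h.c_pos; have := h.α_pos; have := h.energy_pos; have := h.invRadius_pos φ
  have := h.angMom_pos
  positivity

lemma clock_add (h : Admissible m c α κ e) (φ : ℝ) :
    clock m c α κ e (φ + 2 * Real.pi / κ) = clock m c α κ e φ + radialPeriod m c α κ e := by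
  have hκ := h.κ_pos
  have e1 : κ * (φ + 2 * Real.pi / κ) = κ * φ + 2 * Real.pi := by field_simp
  have hη := Real.sqrt_pos.2 h.one_sub_e_sq_pos
  have hl := Real.sqrt_pos.2 h.one_sub_κ_sq_pos
  have hd := Real.sqrt_pos.2 h.discr_pos
  have hη2 := Real.sq_sqrt h.one_sub_e_sq_pos.le
  have hl2 := Real.sq_sqrt h.one_sub_κ_sq_pos.le
  have hd2 := Real.sq_sqrt h.discr_pos.le
  have := h.c_pos; have := h.α_pos; have := h.m_pos
  have key : 1 / κ * (energy m c κ e / (c ^ 2 * angMom c α κ * meanInvRadius m c α κ e ^ 2) *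
      (1 / (1 - e ^ 2) * (2 * Real.pi / √(1 - e ^ 2))) +
    α / (c ^ 2 * angMom c α κ * meanInvRadius m c α κ e) *
      (2 * Real.pi / √(1 - e ^ 2))) = radialPeriod m c α κ e := by
    unfold meanInvRadius radialPeriod angMom energy Tstar
    rw [← hη2, ← hl2]
    set η := √(1 - e ^ 2)
    set l := √(1 - κ ^ 2)
    set d := √(1 - e ^ 2 * (1 - κ ^ 2))
    have hd3 : d ^ 2 = κ ^ 2 + l ^ 2 * η ^ 2 := by rw [hd2, hl2, hη2]; ring
    have hd4 : √(1 - e ^ 2 * l ^ 2) = d := by rw [hl2]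
    simp only [hd4, Real.sqrt_sq hη.le, Real.sqrt_sq hl.le]
    clear_value d η l
    field_simp
    rw [hd3]
  rw [← key]
  unfold clock
  rw [e1, eccAnomaly_add_two_pi, Real.sin_add_two_pi, Real.cos_add_two_pi]
  ring

lemma clock_zero (m c α κ e : ℝ) : clock m c α κ e 0 = 0 := by
  simp [clock, eccAnomaly]

end Admissible
end RelKepler

/-! ### Rosette orbits are solutions of type `(n, k)` -/

namespace RelKepler

/-- A continuous function on the line with `f (x + a) = f x + b`, `b > 0`, is onto. -/
lemma surjective_of_add_eq_add {f : ℝ → ℝ} {a b : ℝ} (hf : Continuous f) (hb : 0 < b)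
    (hab : ∀ x, f (x + a) = f x + b) : Function.Surjective f := by
  have h1 : ∀ n : ℕ, f (n * a) = f 0 + n * b := by
    intro n
    induction n with
    | zero => simp
    | succ n ih => push_cast; rw [add_one_mul, hab, ih]; ring
  have h2 : ∀ n : ℕ, f (-(n * a)) = f 0 - n * b := by
    intro n
    induction n with
    | zero => simp
    | succ n ih =>
      have := hab (-((n + 1 : ℕ) * a))
      have e : -(((n + 1 : ℕ) : ℝ) * a) + a = -(n * a) := by push_cast; ring
      rw [e, ih] at this
      push_cast at this ⊢
      linarith
  intro y
  obtain ⟨n, hn⟩ := exists_nat_ge (|y - f 0| / b)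
  rw [div_le_iff₀ hb] at hn
  have hn' := abs_le.1 hn
  refine mem_range_of_exists_le_of_exists_ge hf ⟨-(n * a), ?_⟩ ⟨n * a, ?_⟩
  · rw [h2]; linarith
  · rw [h1]; linarith

/-- The second order equation follows from Hamilton's equations `x' = p / M`,
`p' = - α x / |x|³`, where `M = m γ` is the relativistic mass, `M² = m² + |p|² / c²`. -/
lemma isSolution_of_hamiltonian {m c α : ℝ} (hm : 0 < m) (hc : 0 < c) {x p : ℝ → ℂ} {M : ℝ → ℝ}
    (hx0 : ∀ t, x t ≠ 0) (hM : ∀ t, 0 < M t) (hM2 : ∀ t, M t ^ 2 = m ^ 2 + ‖p t‖ ^ 2 / c ^ 2)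
    (hx : ∀ t, HasDerivAt x (((M t)⁻¹ : ℝ) • p t) t)
    (hp : ∀ t, HasDerivAt p (-((α / ‖x t‖ ^ 3) • x t)) t) : IsSolution m c α x := by
  have hd : ∀ t, deriv x t = ((M t)⁻¹ : ℝ) • p t := fun t => (hx t).deriv
  have hn : ∀ t, ‖deriv x t‖ = ‖p t‖ / M t := fun t => by
    rw [hd, norm_smul, Real.norm_of_nonneg (inv_nonneg.2 (hM t).le)]; ring
  have hmom : (fun s => momentum m c (deriv x s)) = p := by
    funext t
    have hMt := hM t
    have e1 : 1 - ‖deriv x t‖ ^ 2 / c ^ 2 = (m / M t) ^ 2 := by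
      rw [hn]
      have h1 : ‖p t‖ ^ 2 / c ^ 2 = M t ^ 2 - m ^ 2 := by rw [hM2 t]; ring
      have e2 : (‖p t‖ / M t) ^ 2 / c ^ 2 = ‖p t‖ ^ 2 / c ^ 2 / M t ^ 2 := by ring
      rw [e2, h1]; field_simp; ring
    unfold momentum
    rw [e1, Real.sqrt_sq (by positivity), hd, smul_smul]
    have e3 : m / (m / M t) * (M t)⁻¹ = 1 := by field_simp
    rw [e3, one_smul]
  refine ⟨hx0, fun t => (hx t).differentiableAt, fun t => ?_, fun t => hmom ▸ hp t⟩
  rw [hn, div_lt_iff₀ (hM t)]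
  refine lt_of_pow_lt_pow_left₀ 2 (mul_nonneg hc.le (hM t).le) ?_
  rw [mul_pow, hM2 t]
  have : c ^ 2 * (m ^ 2 + ‖p t‖ ^ 2 / c ^ 2) = c ^ 2 * m ^ 2 + ‖p t‖ ^ 2 := by field_simp
  rw [this]
  have : 0 < c ^ 2 * m ^ 2 := by positivity
  linarith

/-- The integrand of the winding number is the imaginary part of the logarithmic derivative. -/
lemma winding_integrand_eq {x v z : ℂ} (hx : x ≠ 0) (h : v = z * x) :
    (x.re * v.im - x.im * v.re) / (x.re ^ 2 + x.im ^ 2) = z.im := by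
  have h0 : x.re ^ 2 + x.im ^ 2 ≠ 0 := by
    have := Complex.normSq_pos.2 hx
    rw [Complex.normSq_apply] at this
    nlinarith
  rw [h, div_eq_iff h0, Complex.mul_re, Complex.mul_im]
  ring

/-- The polar angle of the rosette orbit as a function of time: the inverse of `clock`,
which is bijective for admissible parameters. -/
noncomputable def orbitAngle (m c α κ e : ℝ) : ℝ → ℝ := Function.invFun (clock m c α κ e)

/-- The rosette orbit that passes its pericenter at time `0`, on the positive real axis. -/
noncomputable def orbit (m c α κ e t : ℝ) : ℂ :=
  ((invRadius m c α κ e (orbitAngle m c α κ e t))⁻¹ : ℝ) *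
    Complex.exp (orbitAngle m c α κ e t * Complex.I)

namespace Admissible

variable {m c α κ e : ℝ}

lemma clock_strictMono (h : Admissible m c α κ e) : StrictMono (clock m c α κ e) :=
  strictMono_of_deriv_pos fun φ => by rw [(h.hasDerivAt_clock φ).deriv]; exact h.clock_deriv_pos φ

lemma radialPeriod_pos (h : Admissible m c α κ e) : 0 < radialPeriod m c α κ e := by
  have h1 := Real.sqrt_pos.2 h.one_sub_e_sq_pos
  have h2 := Real.sqrt_pos.2 h.one_sub_κ_sq_pos
  have h3 := Real.sqrt_pos.2 h.discr_pos
  have := h.m_pos; have := h.c_pos; have := h.α_pos; have := Real.pi_pos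
  unfold radialPeriod Tstar
  positivity

lemma clock_surjective (h : Admissible m c α κ e) : Function.Surjective (clock m c α κ e) :=
  surjective_of_add_eq_add
    (continuous_iff_continuousAt.2 fun φ => (h.hasDerivAt_clock φ).continuousAt)
    h.radialPeriod_pos h.clock_add

lemma clock_orbitAngle (h : Admissible m c α κ e) (t : ℝ) :
    clock m c α κ e (orbitAngle m c α κ e t) = t :=
  Function.rightInverse_invFun h.clock_surjective t

lemma orbitAngle_clock (h : Admissible m c α κ e) (φ : ℝ) :
    orbitAngle m c α κ e (clock m c α κ e φ) = φ :=
  Function.leftInverse_invFun h.clock_strictMono.injective φ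

lemma orbitAngle_strictMono (h : Admissible m c α κ e) : StrictMono (orbitAngle m c α κ e) := by
  intro s t hst
  rw [← h.clock_strictMono.lt_iff_lt, h.clock_orbitAngle, h.clock_orbitAngle]
  exact hst

lemma continuous_orbitAngle (h : Admissible m c α κ e) : Continuous (orbitAngle m c α κ e) :=
  h.orbitAngle_strictMono.monotone.continuous_of_surjective fun φ => ⟨_, h.orbitAngle_clock φ⟩

lemma hasDerivAt_orbitAngle (h : Admissible m c α κ e) (t : ℝ) :
    HasDerivAt (orbitAngle m c α κ e)
      ((energy m c κ e + α * invRadius m c α κ e (orbitAngle m c α κ e t)) /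
        (c ^ 2 * angMom c α κ * invRadius m c α κ e (orbitAngle m c α κ e t) ^ 2))⁻¹ t :=
  (h.hasDerivAt_clock _).of_local_left_inverse h.continuous_orbitAngle.continuousAt
    (h.clock_deriv_pos _).ne' (Filter.Eventually.of_forall h.clock_orbitAngle)

lemma clock_add_nat_mul (h : Admissible m c α κ e) (n : ℕ) (φ : ℝ) :
    clock m c α κ e (φ + n * (2 * Real.pi / κ)) =
      clock m c α κ e φ + n * radialPeriod m c α κ e := by
  induction n with
  | zero => simp
  | succ n ih => push_cast; rw [add_one_mul, ← add_assoc, h.clock_add, ih]; ring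

lemma orbitAngle_add_nat_mul (h : Admissible m c α κ e) (n : ℕ) (t : ℝ) :
    orbitAngle m c α κ e (t + n * radialPeriod m c α κ e) =
      orbitAngle m c α κ e t + n * (2 * Real.pi / κ) := by
  apply h.clock_strictMono.injective
  rw [h.clock_add_nat_mul, h.clock_orbitAngle, h.clock_orbitAngle]

lemma orbitAngle_zero (h : Admissible m c α κ e) : orbitAngle m c α κ e 0 = 0 := by
  have := h.orbitAngle_clock 0
  rwa [clock_zero] at this

lemma invRadius_add_nat_mul (h : Admissible m c α κ e) (n : ℕ) (φ : ℝ) :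
    invRadius m c α κ e (φ + n * (2 * Real.pi / κ)) = invRadius m c α κ e φ := by
  have hκ := h.κ_pos
  unfold invRadius
  have : κ * (φ + n * (2 * Real.pi / κ)) = κ * φ + n * (2 * Real.pi) := by field_simp
  rw [this, Real.cos_add_nat_mul_two_pi]

lemma norm_orbit (h : Admissible m c α κ e) (t : ℝ) :
    ‖orbit m c α κ e t‖ = (invRadius m c α κ e (orbitAngle m c α κ e t))⁻¹ := by
  unfold orbit
  rw [norm_mul, Complex.norm_exp_ofReal_mul_I, mul_one, Complex.norm_real,
    Real.norm_of_nonneg (inv_nonneg.2 (h.invRadius_pos _).le)]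

lemma orbit_ne_zero (h : Admissible m c α κ e) (t : ℝ) : orbit m c α κ e t ≠ 0 := by
  rw [← norm_pos_iff, h.norm_orbit]
  exact inv_pos.2 (h.invRadius_pos _)

/-- The logarithmic derivative of the orbit is `θ' (- U' / U + i)`. -/
lemma hasDerivAt_orbit (h : Admissible m c α κ e) (t : ℝ) :
    HasDerivAt (orbit m c α κ e)
      (((deriv (orbitAngle m c α κ e) t : ℝ) : ℂ) *
        ((meanInvRadius m c α κ e * (e * (κ * Real.sin (κ * orbitAngle m c α κ e t))) : ℝ) /
          invRadius m c α κ e (orbitAngle m c α κ e t) + Complex.I) * orbit m c α κ e t) t := by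
  have hθ := (h.hasDerivAt_orbitAngle t).differentiableAt.hasDerivAt
  have hU := (hasDerivAt_invRadius m c α κ e (orbitAngle m c α κ e t)).comp t hθ
  have hU0 := (h.invRadius_pos (orbitAngle m c α κ e t)).ne'
  have h1 := (hU.inv hU0).ofReal_comp.mul ((hθ.ofReal_comp.mul_const Complex.I).cexp)
  refine h1.congr_deriv ?_
  unfold orbit
  have hU0' : (invRadius m c α κ e (orbitAngle m c α κ e t) : ℂ) ≠ 0 := by exact_mod_cast hU0
  simp only [Function.comp_apply, Pi.inv_apply]
  push_cast
  field_simp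

/-- The momentum along the rosette orbit: radial part `- L U'`, tangential part `L U`. -/
lemma hasDerivAt_orbit_momentum (h : Admissible m c α κ e) (t : ℝ) :
    HasDerivAt (fun t => (angMom c α κ : ℂ) *
      ((meanInvRadius m c α κ e * (e * (κ * Real.sin (κ * orbitAngle m c α κ e t))) : ℝ) +
        (invRadius m c α κ e (orbitAngle m c α κ e t) : ℝ) * Complex.I) *
        Complex.exp (orbitAngle m c α κ e t * Complex.I))
      (-((α / ‖orbit m c α κ e t‖ ^ 3) • orbit m c α κ e t)) t := by
  have hθ := h.hasDerivAt_orbitAngle t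
  have hU := (hasDerivAt_invRadius m c α κ e (orbitAngle m c α κ e t)).comp t hθ
  have hU0 := h.invRadius_pos (orbitAngle m c α κ e t)
  have hS := ((((hθ.const_mul κ).sin).const_mul κ).const_mul e).const_mul
    (meanInvRadius m c α κ e)
  have h1 := ((hS.ofReal_comp.add (hU.ofReal_comp.mul_const Complex.I)).const_mul
    (angMom c α κ : ℂ)).mul ((hθ.ofReal_comp.mul_const Complex.I).cexp)
  refine h1.congr_deriv ?_
  have hb := h.binet (orbitAngle m c α κ e t)
  have hg := h.clock_deriv_pos (orbitAngle m c α κ e t)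
  rw [h.norm_orbit]
  unfold orbit
  have hcos : meanInvRadius m c α κ e * e * Real.cos (κ * orbitAngle m c α κ e t) =
      invRadius m c α κ e (orbitAngle m c α κ e t) - meanInvRadius m c α κ e := by
    unfold invRadius; ring
  have := h.c_pos; have := h.α_pos; have := h.angMom_pos; have := h.energy_pos
  -- `p' = - L θ' (U + U'') e^{iθ}`
  have key : angMom c α κ * (invRadius m c α κ e (orbitAngle m c α κ e t) -
      κ ^ 2 * (meanInvRadius m c α κ e * e * Real.cos (κ * orbitAngle m c α κ e t))) *
      ((energy m c κ e + α * invRadius m c α κ e (orbitAngle m c α κ e t)) /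
        (c ^ 2 * angMom c α κ * invRadius m c α κ e (orbitAngle m c α κ e t) ^ 2))⁻¹ =
      α / (invRadius m c α κ e (orbitAngle m c α κ e t))⁻¹ ^ 3 *
        (invRadius m c α κ e (orbitAngle m c α κ e t))⁻¹ := by
    rw [hcos, hb]
    field_simp
  have key' := congrArg (fun r : ℝ => (r : ℂ)) key
  simp only [Function.comp_apply, Complex.real_smul, Pi.add_apply]
  push_cast at key' ⊢
  linear_combination (-Complex.exp (orbitAngle m c α κ e t * Complex.I)) * key' +
    (angMom c α κ * invRadius m c α κ e (orbitAngle m c α κ e t) *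
      ((energy m c κ e + α * invRadius m c α κ e (orbitAngle m c α κ e t)) /
        (c ^ 2 * angMom c α κ * invRadius m c α κ e (orbitAngle m c α κ e t) ^ 2))⁻¹ *
      Complex.exp (orbitAngle m c α κ e t * Complex.I)) * Complex.I_sq

lemma isSolution_orbit (h : Admissible m c α κ e) : IsSolution m c α (orbit m c α κ e) := by
  have hc := h.c_pos; have hα := h.α_pos; have hL := h.angMom_pos; have hH := h.energy_pos
  refine isSolution_of_hamiltonian h.m_pos h.c_pos
    (M := fun t => (energy m c κ e + α * invRadius m c α κ e (orbitAngle m c α κ e t)) / c ^ 2)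
    h.orbit_ne_zero (fun t => ?_) (fun t => ?_) (fun t => ?_) h.hasDerivAt_orbit_momentum
  · have := h.invRadius_pos (orbitAngle m c α κ e t)
    positivity
  · rw [norm_mul, norm_mul, Complex.norm_exp_ofReal_mul_I, mul_one, Complex.norm_real, mul_pow,
      Complex.sq_norm, Complex.normSq_add_mul_I, Real.norm_eq_abs, sq_abs, div_pow,
      h.energy_relation]
    field_simp
  · refine (h.hasDerivAt_orbit t).congr_deriv ?_
    rw [(h.hasDerivAt_orbitAngle t).deriv]
    have hU0 := h.invRadius_pos (orbitAngle m c α κ e t)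
    have hU0' : (invRadius m c α κ e (orbitAngle m c α κ e t) : ℂ) ≠ 0 := by exact_mod_cast hU0.ne'
    have hc' : (c : ℂ) ≠ 0 := by exact_mod_cast hc.ne'
    have hL' : (angMom c α κ : ℂ) ≠ 0 := by exact_mod_cast hL.ne'
    have hE' : (energy m c κ e + α * invRadius m c α κ e (orbitAngle m c α κ e t) : ℂ) ≠ 0 := by
      have : 0 < energy m c κ e + α * invRadius m c α κ e (orbitAngle m c α κ e t) := by positivity
      exact_mod_cast this.ne'
    unfold orbit
    rw [Complex.real_smul]
    push_cast
    field_simp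

lemma continuous_invRadius (m c α κ e : ℝ) : Continuous (invRadius m c α κ e) :=
  continuous_iff_continuousAt.2 fun φ => (hasDerivAt_invRadius m c α κ e φ).continuousAt

lemma windingNumber_orbit (h : Admissible m c α κ e) (T : ℝ) :
    windingNumber T (orbit m c α κ e) =
      1 / (2 * Real.pi) * (orbitAngle m c α κ e T - orbitAngle m c α κ e 0) := by
  have hI : ∀ t, ((orbit m c α κ e t).re * (deriv (orbit m c α κ e) t).im -
      (orbit m c α κ e t).im * (deriv (orbit m c α κ e) t).re) /
      ((orbit m c α κ e t).re ^ 2 + (orbit m c α κ e t).im ^ 2) =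
      deriv (orbitAngle m c α κ e) t := fun t => by
    rw [winding_integrand_eq (h.orbit_ne_zero t) (h.hasDerivAt_orbit t).deriv,
      Complex.im_ofReal_mul, Complex.add_im, ← Complex.ofReal_div, Complex.ofReal_im,
      Complex.I_im, zero_add, mul_one]
  unfold windingNumber
  simp_rw [hI]
  rw [intervalIntegral.integral_deriv_eq_sub
    (fun t _ => (h.hasDerivAt_orbitAngle t).differentiableAt)]
  apply Continuous.intervalIntegrable
  have hd : deriv (orbitAngle m c α κ e) = fun t => _ :=
    funext fun t => (h.hasDerivAt_orbitAngle t).deriv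
  rw [hd]
  have hUc : Continuous fun t => invRadius m c α κ e (orbitAngle m c α κ e t) :=
    (continuous_invRadius m c α κ e).comp h.continuous_orbitAngle
  refine Continuous.inv₀ (Continuous.div (by fun_prop) (by fun_prop) fun t => ?_)
    fun t => (h.clock_deriv_pos _).ne'
  have := h.c_pos; have := h.angMom_pos; have := h.invRadius_pos (orbitAngle m c α κ e t)
  positivity

end Admissible

/-- Solutions move slower than light, so they are Lipschitz. -/
lemma IsSolution.exists_lipschitzWith {m c α : ℝ} {x : ℝ → ℂ} (h : IsSolution m c α x) :
    ∃ K, LipschitzWith K x :=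
  ⟨‖c‖₊, lipschitzWith_of_nnnorm_deriv_le h.differentiable fun t => by
    rw [← NNReal.coe_le_coe, coe_nnnorm, coe_nnnorm]
    exact (h.speed_lt t).le.trans (le_abs_self c)⟩

/-- The rosette orbit with frequency ratio `n / k` closes after `n` radial periods, during which it
winds `k` times around the origin. -/
lemma isOfType_orbit {m c α T e : ℝ} {n k : ℕ} (hn : 1 ≤ n) (hnk : n < k)
    (h : Admissible m c α (n / k) e) (hT : n * radialPeriod m c α (n / k) e = T) :
    IsOfType m c α T n k (orbit m c α (n / k) e) := by
  have hn0 : (0 : ℝ) < n := by exact_mod_cast hn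
  have hk0 : (0 : ℝ) < k := by exact_mod_cast (show 0 < k by omega)
  have hP : T / n = radialPeriod m c α (n / k) e := by rw [← hT]; field_simp
  have hnκ : (n : ℝ) * (2 * Real.pi / (n / k)) = k * (2 * Real.pi) := by field_simp
  have hadd : ∀ t, orbitAngle m c α (n / k) e (t + T) =
      orbitAngle m c α (n / k) e t + k * (2 * Real.pi) := fun t => by
    rw [← hT, h.orbitAngle_add_nat_mul, hnκ]
  have hUadd : ∀ φ, invRadius m c α (n / k) e (φ + k * (2 * Real.pi)) =
      invRadius m c α (n / k) e φ := fun φ => by rw [← hnκ, h.invRadius_add_nat_mul]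
  -- the radius returns to its value at the pericenter only at multiples of the radial period
  have hret : ∀ σ, 0 < σ → ‖orbit m c α (n / k) e σ‖ = ‖orbit m c α (n / k) e 0‖ →
      radialPeriod m c α (n / k) e ≤ σ := by
    intro σ hσ heq
    rw [h.norm_orbit, h.norm_orbit, inv_inj, h.orbitAngle_zero] at heq
    unfold invRadius at heq
    have h1 := mul_left_cancel₀ h.meanInvRadius_pos.ne' heq
    have h2 : Real.cos (n / k * orbitAngle m c α (n / k) e σ) = 1 := by
      have := mul_left_cancel₀ h.e_pos.ne' (add_left_cancel h1)
      rw [this]; simp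
    obtain ⟨j, hj⟩ := (Real.cos_eq_one_iff _).1 h2
    have hpos : 0 < orbitAngle m c α (n / k) e σ := by
      have := h.orbitAngle_strictMono hσ
      rwa [h.orbitAngle_zero] at this
    have hj0 : (0 : ℝ) < j := by
      have := mul_pos h.κ_pos hpos
      rw [← hj] at this
      exact pos_of_mul_pos_left this (by positivity)
    have hj1 : (1 : ℝ) ≤ j := by exact_mod_cast (show (1 : ℤ) ≤ j by exact_mod_cast hj0)
    have h3 : 2 * Real.pi / (n / k) ≤ orbitAngle m c α (n / k) e σ := by
      rw [div_le_iff₀ h.κ_pos, mul_comm _ ((n : ℝ) / k), ← hj]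
      nlinarith [Real.pi_pos]
    have h4 := h.orbitAngle_add_nat_mul 1 0
    rw [h.orbitAngle_zero] at h4
    simp only [Nat.cast_one, one_mul, zero_add] at h4
    rw [← h4] at h3
    exact h.orbitAngle_strictMono.le_iff_le.1 h3
  refine ⟨by omega, ⟨hn, by omega⟩,
    ⟨h.isSolution_orbit, ⟨h.isSolution_orbit.exists_lipschitzWith, fun t => ?_, h.orbit_ne_zero, ?_⟩,
      ?_⟩, ?_⟩
  · unfold orbit
    rw [hadd, hUadd]
    congr 1
    push_cast
    rw [add_mul, Complex.exp_add, mul_assoc (k : ℂ), Complex.exp_nat_mul_two_pi_mul_I, mul_one]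
  · have := hadd 0
    rw [zero_add] at this
    rw [h.windingNumber_orbit, this]
    have := Real.pi_pos
    push_cast
    field_simp
    ring
  · rintro ⟨R, hR⟩
    have h0 := h.radialPeriod_pos
    have := hret (radialPeriod m c α (n / k) e / 2) (by linarith) (by rw [hR, hR])
    linarith
  · rw [hP]
    refine ⟨⟨h.radialPeriod_pos, fun t => ?_⟩, fun σ hσ => ?_⟩
    · have h1 := h.orbitAngle_add_nat_mul 1 t
      have h2 := h.invRadius_add_nat_mul 1 (orbitAngle m c α (n / k) e t)
      rw [← h1] at h2
      simp only [Nat.cast_one, one_mul] at h2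
      simp only [h.norm_orbit, h2]
    · have := hσ.2 0
      simp only [zero_add] at this
      exact hret σ hσ.1 this

end RelKepler

/-! ### Conservation laws and the reduced radial equation -/

namespace RelKepler

/-- Hamilton's equations in coordinates: position `(X, Y)`, momentum `(a, b)`, radius `r`,
relativistic mass `M`. -/
structure IsHamiltonFlow (m c α : ℝ) (X Y a b r M : ℝ → ℝ) : Prop where
  c_pos : 0 < c
  r_pos : ∀ t, 0 < r t
  M_pos : ∀ t, 0 < M t
  r_sq : ∀ t, r t ^ 2 = X t ^ 2 + Y t ^ 2
  M_sq : ∀ t, c ^ 2 * M t ^ 2 = c ^ 2 * m ^ 2 + (a t ^ 2 + b t ^ 2)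
  hasDerivAt_X : ∀ t, HasDerivAt X (a t / M t) t
  hasDerivAt_Y : ∀ t, HasDerivAt Y (b t / M t) t
  hasDerivAt_a : ∀ t, HasDerivAt a (-(α / r t ^ 3 * X t)) t
  hasDerivAt_b : ∀ t, HasDerivAt b (-(α / r t ^ 3 * Y t)) t

/-- A positive function is differentiable as soon as its square is. -/
lemma hasDerivAt_of_sq {f g : ℝ → ℝ} {g' t : ℝ} (hf : ∀ t, 0 < f t) (hfg : ∀ t, f t ^ 2 = g t)
    (hg : HasDerivAt g g' t) : HasDerivAt f (g' / (2 * f t)) t := by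
  have e : f = fun t => √(g t) := by
    funext t; rw [← hfg, Real.sqrt_sq (hf t).le]
  have h0 : g t ≠ 0 := by rw [← hfg]; exact (pow_pos (hf t) 2).ne'
  have h1 := hg.sqrt h0
  rw [← hfg t, Real.sqrt_sq (hf t).le] at h1
  exact h1.congr_of_eventuallyEq (Filter.Eventually.of_forall (congrFun e))

namespace IsHamiltonFlow

variable {m c α : ℝ} {X Y a b r M : ℝ → ℝ}

lemma hasDerivAt_r (h : IsHamiltonFlow m c α X Y a b r M) (t : ℝ) :
    HasDerivAt r ((X t * a t + Y t * b t) / (M t * r t)) t := by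
  have h1 := hasDerivAt_of_sq h.r_pos h.r_sq
    (((h.hasDerivAt_X t).pow 2).add ((h.hasDerivAt_Y t).pow 2))
  refine h1.congr_deriv ?_
  have := h.r_pos t; have := h.M_pos t
  field_simp
  ring

lemma hasDerivAt_M (h : IsHamiltonFlow m c α X Y a b r M) (t : ℝ) :
    HasDerivAt M (-(α * (X t * a t + Y t * b t)) / (c ^ 2 * M t * r t ^ 3)) t := by
  have hc := h.c_pos
  have h1 := hasDerivAt_of_sq (g := fun t => (c ^ 2 * m ^ 2 + (a t ^ 2 + b t ^ 2)) / c ^ 2) h.M_pos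
    (fun t => by rw [← h.M_sq]; field_simp)
    (((((h.hasDerivAt_a t).pow 2).add ((h.hasDerivAt_b t).pow 2)).const_add _).div_const _)
  refine h1.congr_deriv ?_
  have := h.r_pos t; have := h.M_pos t
  field_simp
  ring

/-- Conservation of angular momentum. -/
lemma angularMomentum_eq (h : IsHamiltonFlow m c α X Y a b r M) (t s : ℝ) :
    X t * b t - Y t * a t = X s * b s - Y s * a s := by
  have hd : ∀ t, HasDerivAt (fun t => X t * b t - Y t * a t) 0 t := fun t => by
    refine (((h.hasDerivAt_X t).mul (h.hasDerivAt_b t)).sub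
      ((h.hasDerivAt_Y t).mul (h.hasDerivAt_a t))).congr_deriv ?_
    ring
  exact is_const_of_deriv_eq_zero (fun t => (hd t).differentiableAt) (fun t => (hd t).deriv) t s

/-- Conservation of energy. -/
lemma energy_eq (h : IsHamiltonFlow m c α X Y a b r M) (t s : ℝ) :
    c ^ 2 * M t - α * (r t)⁻¹ = c ^ 2 * M s - α * (r s)⁻¹ := by
  have hd : ∀ t, HasDerivAt (fun t => c ^ 2 * M t - α * (r t)⁻¹) 0 t := fun t => by
    have hr := h.r_pos t; have := h.M_pos t; have := h.c_pos
    refine (((h.hasDerivAt_M t).const_mul (c ^ 2)).sub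
      (((h.hasDerivAt_r t).inv hr.ne').const_mul α)).congr_deriv ?_
    field_simp
    ring
  exact is_const_of_deriv_eq_zero (fun t => (hd t).differentiableAt) (fun t => (hd t).deriv) t s

lemma hasDerivAt_inv_r (h : IsHamiltonFlow m c α X Y a b r M) (t : ℝ) :
    HasDerivAt (fun t => (r t)⁻¹) (-(X t * a t + Y t * b t) / (M t * r t ^ 3)) t := by
  have hr := h.r_pos t; have := h.M_pos t
  refine ((h.hasDerivAt_r t).inv hr.ne').congr_deriv ?_
  field_simp

/-- The radial momentum `⟪x, p⟫ / |x|` satisfies `p_r' = L² / (M r³) - α / r²`. -/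
lemma hasDerivAt_radialMomentum (h : IsHamiltonFlow m c α X Y a b r M) (t : ℝ) :
    HasDerivAt (fun t => (X t * a t + Y t * b t) / r t)
      ((X t * b t - Y t * a t) ^ 2 / (M t * r t ^ 3) - α / r t ^ 2) t := by
  have hr := h.r_pos t; have hM := h.M_pos t
  refine ((((h.hasDerivAt_X t).mul (h.hasDerivAt_a t)).add
    ((h.hasDerivAt_Y t).mul (h.hasDerivAt_b t))).div (h.hasDerivAt_r t) hr.ne').congr_deriv ?_
  have hr2 := h.r_sq t
  simp only [Pi.add_apply, Pi.mul_apply]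
  field_simp
  linear_combination (r t * (a t ^ 2 + b t ^ 2) + α * M t) * hr2

end IsHamiltonFlow

/-- A periodic function with nonnegative derivative has derivative zero. -/
lemma eq_zero_of_periodic_of_deriv_nonneg {g g' : ℝ → ℝ} {T : ℝ} (hT : 0 < T)
    (hg : ∀ t, HasDerivAt g (g' t) t) (h0 : ∀ t, 0 ≤ g' t) (hp : Function.Periodic g T) (t : ℝ) :
    g' t = 0 := by
  have hmono : Monotone g := monotone_of_deriv_nonneg (fun t => (hg t).differentiableAt)
    fun t => by rw [(hg t).deriv]; exact h0 t
  have hle : ∀ s t, g s ≤ g t := fun s t => by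
    obtain ⟨n, hn⟩ := exists_nat_ge ((s - t) / T)
    rw [div_le_iff₀ hT] at hn
    rw [← hp.nat_mul n t]
    exact hmono (by linarith)
  have hc : g = fun _ => g t := funext fun s => le_antisymm (hle s t) (hle t s)
  have := hg t
  rw [hc] at this
  exact this.unique (hasDerivAt_const t (g t))

/-- For angular momenta `|L| ≤ α / c` the radial equation, written with respect to the polar angle
(of speed `ω`) as `u'' + K u = β` with `K ≤ 0`, has no periodic solutions but constants. -/
lemma const_of_nonpos {u w ω : ℝ → ℝ} {K β T : ℝ} (hT : 0 < T) (hK : K ≤ 0)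
    (hω : ∀ t, 0 < ω t) (hu : ∀ t, HasDerivAt u (w t * ω t) t)
    (hw : ∀ t, HasDerivAt w (ω t * (β - K * u t)) t)
    (hup : Function.Periodic u T) (hwp : Function.Periodic w T) (s t : ℝ) : u s = u t := by
  suffices hw0 : ∀ t, w t = 0 from
    is_const_of_deriv_eq_zero (fun t => (hu t).differentiableAt)
      (fun t => by rw [(hu t).deriv, hw0, zero_mul]) s t
  -- the derivative of the periodic function `(u - A) w`, where `β = K A`, is `ω (w² - K (u - A)²)`
  have main : ∀ A, β = K * A → ∀ t, w t = 0 := by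
    intro A hA t
    have hd : ∀ t, HasDerivAt (fun t => (u t - A) * w t)
        (ω t * (w t ^ 2 + -K * (u t - A) ^ 2)) t := fun t => by
      refine (((hu t).sub_const A).mul (hw t)).congr_deriv ?_
      rw [hA]; ring
    have hz := eq_zero_of_periodic_of_deriv_nonneg hT hd (fun t =>
      mul_nonneg (hω t).le (add_nonneg (sq_nonneg _) (mul_nonneg (neg_nonneg.2 hK) (sq_nonneg _))))
      (fun t => by simp only [hup t, hwp t]) t
    have h1 := (mul_eq_zero.1 hz).resolve_left (hω t).ne'
    have h2 : 0 ≤ -K * (u t - A) ^ 2 := mul_nonneg (neg_nonneg.2 hK) (sq_nonneg _)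
    have h3 : w t ^ 2 = 0 := le_antisymm (by linarith) (sq_nonneg _)
    exact pow_eq_zero_iff two_ne_zero |>.1 h3
  rcases eq_or_lt_of_le hK with rfl | hK
  · -- here `w' = β ω`, so `β = 0` because `w` is periodic
    have hd : ∀ t, HasDerivAt (fun t => β * w t) (β ^ 2 * ω t) t := fun t =>
      ((hw t).const_mul β).congr_deriv (by ring)
    have hz := eq_zero_of_periodic_of_deriv_nonneg hT hd
      (fun t => mul_nonneg (sq_nonneg _) (hω t).le) (fun t => by simp only [hwp t]) 0
    have hβ : β = 0 :=
      pow_eq_zero_iff two_ne_zero |>.1 ((mul_eq_zero.1 hz).resolve_right (hω 0).ne')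
    exact main 0 (by rw [hβ, mul_zero])
  · exact main (β / K) (by rw [mul_div_cancel₀ _ hK.ne])

/-- For `K = κ² > 0` the radial equation integrates to a cosine of the polar angle `θ`. -/
lemma eq_cos_of_pos {u w ω θ : ℝ → ℝ} {κ A t₀ : ℝ} (hκ : 0 < κ)
    (hu : ∀ t, HasDerivAt u (w t * ω t) t)
    (hw : ∀ t, HasDerivAt w (ω t * (κ ^ 2 * A - κ ^ 2 * u t)) t)
    (hθ : ∀ t, HasDerivAt θ (ω t) t) (h0 : w t₀ = 0) (t : ℝ) :
    u t = A + (u t₀ - A) * Real.cos (κ * (θ t - θ t₀)) := by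
  have hψ : ∀ t, HasDerivAt (fun t => κ * (θ t - θ t₀)) (κ * ω t) t := fun t =>
    ((hθ t).sub_const _).const_mul κ
  have hC : ∀ t, HasDerivAt (fun t => (u t - A) * Real.cos (κ * (θ t - θ t₀)) -
      w t / κ * Real.sin (κ * (θ t - θ t₀))) 0 t := fun t => by
    refine ((((hu t).sub_const A).mul (hψ t).cos).sub
      (((hw t).div_const κ).mul (hψ t).sin)).congr_deriv ?_
    field_simp
    ring
  have hD : ∀ t, HasDerivAt (fun t => (u t - A) * Real.sin (κ * (θ t - θ t₀)) +
      w t / κ * Real.cos (κ * (θ t - θ t₀))) 0 t := fun t => by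
    refine ((((hu t).sub_const A).mul (hψ t).sin).add
      (((hw t).div_const κ).mul (hψ t).cos)).congr_deriv ?_
    field_simp
    ring
  have hC' := is_const_of_deriv_eq_zero (fun t => (hC t).differentiableAt)
    (fun t => (hC t).deriv) t t₀
  have hD' := is_const_of_deriv_eq_zero (fun t => (hD t).differentiableAt)
    (fun t => (hD t).deriv) t t₀
  simp only [sub_self, mul_zero, Real.cos_zero, Real.sin_zero, h0, zero_div, mul_one, sub_zero,
    add_zero] at hC' hD'
  have h1 := Real.sin_sq_add_cos_sq (κ * (θ t - θ t₀))
  linear_combination Real.cos (κ * (θ t - θ t₀)) * hC' + Real.sin (κ * (θ t - θ t₀)) * hD' -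
    (u t - A) * h1

/-- A continuous periodic function on the line attains its maximum. -/
lemma exists_forall_le_of_periodic {u : ℝ → ℝ} {T : ℝ} (hT : 0 < T) (hu : Continuous u)
    (hp : Function.Periodic u T) : ∃ t₀, ∀ t, u t ≤ u t₀ := by
  obtain ⟨t₀, -, h⟩ := isCompact_Icc.exists_isMaxOn (nonempty_Icc.2 hT.le) hu.continuousOn
  refine ⟨t₀, fun t => ?_⟩
  obtain ⟨s, hs, e⟩ := hp.exists_mem_Ico₀ hT t
  rw [e]
  exact h ⟨hs.1, hs.2.le⟩

/-- The relativistic mass along a curve. -/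
noncomputable def relMass (m c : ℝ) (x : ℝ → ℂ) (t : ℝ) : ℝ := m / √(1 - ‖deriv x t‖ ^ 2 / c ^ 2)

lemma IsSolution.isHamiltonFlow {m c α : ℝ} (hm : 0 < m) (hc : 0 < c) {x : ℝ → ℂ}
    (h : IsSolution m c α x) :
    IsHamiltonFlow m c α (fun t => (x t).re) (fun t => (x t).im)
      (fun t => (momentum m c (deriv x t)).re) (fun t => (momentum m c (deriv x t)).im)
      (fun t => ‖x t‖) (relMass m c x) := by
  have hs : ∀ t, 0 < 1 - ‖deriv x t‖ ^ 2 / c ^ 2 := fun t => by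
    rw [sub_pos, div_lt_one (by positivity)]
    exact pow_lt_pow_left₀ (h.speed_lt t) (norm_nonneg _) two_ne_zero
  have hM : ∀ t, 0 < relMass m c x t := fun t => div_pos hm (Real.sqrt_pos.2 (hs t))
  have hre : ∀ t, (momentum m c (deriv x t)).re = relMass m c x t * (deriv x t).re :=
    fun t => by simp [momentum, relMass]
  have him : ∀ t, (momentum m c (deriv x t)).im = relMass m c x t * (deriv x t).im :=
    fun t => by simp [momentum, relMass]
  have hsq : ∀ z : ℂ, ‖z‖ ^ 2 = z.re ^ 2 + z.im ^ 2 := fun z => by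
    rw [Complex.sq_norm, Complex.normSq_apply]; ring
  refine ⟨hc, fun t => norm_pos_iff.2 (h.ne_zero t), hM, fun t => hsq _, fun t => ?_,
    fun t => ?_, fun t => ?_, fun t => ?_, fun t => ?_⟩
  · have h1 : relMass m c x t ^ 2 * (1 - ‖deriv x t‖ ^ 2 / c ^ 2) = m ^ 2 := by
      unfold relMass
      rw [div_pow, Real.sq_sqrt (hs t).le, div_mul_cancel₀ _ (hs t).ne']
    rw [hre, him, ← h1, hsq]
    field_simp
    ring
  · refine (Complex.reCLM.hasFDerivAt.comp_hasDerivAt t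
      (h.differentiable t).hasDerivAt).congr_deriv ?_
    rw [hre, mul_div_cancel_left₀ _ (hM t).ne']; rfl
  · refine (Complex.imCLM.hasFDerivAt.comp_hasDerivAt t
      (h.differentiable t).hasDerivAt).congr_deriv ?_
    rw [him, mul_div_cancel_left₀ _ (hM t).ne']; rfl
  · refine (Complex.reCLM.hasFDerivAt.comp_hasDerivAt t (h.equation t)).congr_deriv ?_
    rw [Complex.reCLM_apply, Complex.neg_re, Complex.smul_re, smul_eq_mul]
  · refine (Complex.imCLM.hasFDerivAt.comp_hasDerivAt t (h.equation t)).congr_deriv ?_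
    rw [Complex.imCLM_apply, Complex.neg_im, Complex.smul_im, smul_eq_mul]

end RelKepler

/-! ### Classification of the non-circular periodic solutions -/

namespace RelKepler

/-- The logarithmic derivative of a solution, split into its radial and angular parts. -/
lemma IsSolution.hasDerivAt_mul {m c α : ℝ} (hm : 0 < m) (hc : 0 < c) {x : ℝ → ℂ}
    (h : IsSolution m c α x) (t : ℝ) :
    HasDerivAt x (((((x t).re * (momentum m c (deriv x t)).re +
        (x t).im * (momentum m c (deriv x t)).im) / (relMass m c x t * ‖x t‖ ^ 2) : ℝ) +
      (((x t).re * (momentum m c (deriv x t)).im -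
        (x t).im * (momentum m c (deriv x t)).re) / (relMass m c x t * ‖x t‖ ^ 2) : ℝ) *
        Complex.I) * x t) t := by
  have hF := h.isHamiltonFlow hm hc
  have hx := (h.differentiable t).hasDerivAt
  have h1 := (Complex.reCLM.hasFDerivAt.comp_hasDerivAt t hx).unique (hF.hasDerivAt_X t)
  have h2 := (Complex.imCLM.hasFDerivAt.comp_hasDerivAt t hx).unique (hF.hasDerivAt_Y t)
  rw [Complex.reCLM_apply] at h1
  rw [Complex.imCLM_apply] at h2
  have hr := hF.r_pos t
  have hM := hF.M_pos t
  have hr2 := hF.r_sq t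
  refine hx.congr_deriv (Complex.ext ?_ ?_)
  · simp only [h1, Complex.mul_re, Complex.add_re, Complex.add_im, Complex.ofReal_re,
      Complex.ofReal_im, Complex.im_ofReal_mul, Complex.I_re, Complex.I_im,
      mul_zero, mul_one, zero_add]
    field_simp
    rw [hr2]; ring
  · simp only [h2, Complex.mul_im, Complex.add_re, Complex.add_im, Complex.ofReal_re,
      Complex.ofReal_im, Complex.re_ofReal_mul, Complex.I_re, Complex.I_im,
      mul_zero, mul_one, add_zero, zero_add]
    field_simp
    rw [hr2]; ring

/-- The invariants `L`, `H` of a solution and its mean inverse radius are functions of the frequency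
ratio `κ` and of the eccentricity `B / A`. -/
lemma eq_parameters {m c α κ A B L H : ℝ} (hm : 0 < m) (hc : 0 < c) (hα : 0 < α) (hκ : 0 < κ)
    (hκ1 : κ < 1) (hL : 0 < L) (hB : 0 < B) (hBA : B < A)
    (hκL : κ ^ 2 = 1 - α ^ 2 / (c ^ 2 * L ^ 2)) (hA : κ ^ 2 * A = α * H / (c ^ 2 * L ^ 2))
    (hE : (H + α * (A + B)) ^ 2 = m ^ 2 * c ^ 4 + c ^ 2 * L ^ 2 * (A + B) ^ 2) :
    Admissible m c α κ (B / A) ∧ angMom c α κ = L ∧ energy m c κ (B / A) = H ∧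
      meanInvRadius m c α κ (B / A) = A := by
  have hA0 : 0 < A := hB.trans hBA
  have had : Admissible m c α κ (B / A) :=
    ⟨hm, hc, hα, hκ, hκ1, div_pos hB hA0, (div_lt_one hA0).2 hBA⟩
  have hd := had.discr_pos
  have hl := had.one_sub_κ_sq_pos
  have hl' : 1 - κ ^ 2 = (α / (c * L)) ^ 2 := by rw [hκL]; field_simp; ring
  have hang : angMom c α κ = L := by
    unfold angMom
    rw [hl', Real.sqrt_sq (by positivity)]
    field_simp
  have hH : H = A * (α * κ ^ 2) / (1 - κ ^ 2) := by
    rw [hl', eq_div_iff (by positivity)]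
    have : α * (κ ^ 2 * A) = α * (α * H / (c ^ 2 * L ^ 2)) := by rw [hA]
    linear_combination -this
  have hH0 : 0 < H := by rw [hH]; positivity
  have hL2 : c ^ 2 * L ^ 2 = α ^ 2 / (1 - κ ^ 2) := by rw [hl']; field_simp
  have hen : energy m c κ (B / A) = H := by
    rw [← Real.sqrt_sq had.energy_pos.le, ← Real.sqrt_sq hH0.le, had.energy_sq]
    congr 1
    rw [div_eq_iff hd.ne']
    rw [hL2] at hE
    have hm2 : m ^ 2 * c ^ 4 = (H + α * (A + B)) ^ 2 - α ^ 2 / (1 - κ ^ 2) * (A + B) ^ 2 := by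
      linarith
    rw [hm2, hH]
    field_simp
    ring
  refine ⟨had, hang, hen, ?_⟩
  unfold meanInvRadius
  rw [hen, hH]
  field_simp

/-- Every non-circular periodic solution of positive winding number is, up to a motion, one of the
rosette orbits with a rational frequency ratio. -/
theorem exists_orbit_of_mem_nonCircular {m c α T : ℝ} (hm : 0 < m) (hc : 0 < c) (hα : 0 < α)
    (hT : 0 < T) {k : ℕ} (hk : 1 ≤ k) {x : ℝ → ℂ} (hx : x ∈ nonCircular m c α T k) :
    ∃ n : ℕ, 1 ≤ n ∧ n < k ∧ ∃ e, Admissible m c α (n / k) e ∧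
      n * radialPeriod m c α (n / k) e = T ∧ motionSetoid.r (orbit m c α (n / k) e) x := by
  obtain ⟨hsol, ⟨-, hper, hx0, hwind⟩, hnc⟩ := hx
  have hk0 : (0 : ℝ) < k := by exact_mod_cast hk
  have hπ := Real.pi_pos
  have hF := hsol.isHamiltonFlow hm hc
  have hlog := hsol.hasDerivAt_mul hm hc
  have hdper : Function.Periodic (deriv x) T := fun t => by
    rw [← deriv_comp_add_const]
    congr 1
    exact funext hper
  have hpper : ∀ t, momentum m c (deriv x (t + T)) = momentum m c (deriv x t) := fun t => by
    rw [hdper t]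
  have hMper : ∀ t, relMass m c x (t + T) = relMass m c x t := fun t => by
    unfold relMass; rw [hdper t]
  obtain ⟨L, hL⟩ : ∃ L, ∀ t, (x t).re * (momentum m c (deriv x t)).im -
      (x t).im * (momentum m c (deriv x t)).re = L := ⟨_, fun t => hF.angularMomentum_eq t 0⟩
  obtain ⟨H, hH⟩ : ∃ H, ∀ t, c ^ 2 * relMass m c x t - α * ‖x t‖⁻¹ = H :=
    ⟨_, fun t => hF.energy_eq t 0⟩
  have hxpos : ∀ t, 0 < ‖x t‖ := hF.r_pos
  have hMpos := hF.M_pos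
  simp only [hL] at hlog
  set ω : ℝ → ℝ := fun t => L / (relMass m c x t * ‖x t‖ ^ 2) with hω
  have hωc : Continuous ω := by
    refine continuous_const.div (Continuous.mul ?_ ?_) fun t =>
      (mul_pos (hMpos t) (pow_pos (hxpos t) 2)).ne'
    · exact continuous_iff_continuousAt.2 fun t => (hF.hasDerivAt_M t).continuousAt
    · exact hsol.differentiable.continuous.norm.pow 2
  have hωper : ∀ t, ω (t + T) = ω t := fun t => by simp only [hω, hMper, hper t]
  -- the polar angle
  set θ : ℝ → ℝ := fun t => ∫ s in (0 : ℝ)..t, ω s with hθdef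
  have hθ : ∀ t, HasDerivAt θ (ω t) t := fun t =>
    (hωc.integral_hasStrictDerivAt 0 t).hasDerivAt
  have hθT : θ T = k * (2 * Real.pi) := by
    have hI : ∀ t, ((x t).re * (deriv x t).im - (x t).im * (deriv x t).re) /
        ((x t).re ^ 2 + (x t).im ^ 2) = ω t := fun t => by
      rw [winding_integrand_eq (hx0 t) (hlog t).deriv, Complex.add_im,
        Complex.im_ofReal_mul, Complex.ofReal_im, Complex.I_im, mul_one, zero_add]
    unfold windingNumber at hwind
    simp_rw [hI] at hwind
    push_cast at hwind
    rw [← hwind]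
    simp only [hθdef]
    field_simp
  -- the sense of rotation is that of the winding number
  have hLpos : 0 < L := by
    by_contra hL0
    have h1 : 0 ≤ ∫ s in (0 : ℝ)..T, -ω s :=
      intervalIntegral.integral_nonneg hT.le fun s _ => by
        have := hMpos s; have := hxpos s
        rw [neg_nonneg]
        exact div_nonpos_of_nonpos_of_nonneg (not_lt.1 hL0) (by positivity)
    rw [intervalIntegral.integral_neg] at h1
    have h2 : 0 < θ T := by rw [hθT]; positivity
    simp only [hθdef] at h2
    linarith
  have hωpos : ∀ t, 0 < ω t := fun t => div_pos hLpos (mul_pos (hMpos t) (pow_pos (hxpos t) 2))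
  have hθadd : ∀ t, θ (t + T) = θ t + k * (2 * Real.pi) := by
    have hd : ∀ t, HasDerivAt (fun t => θ (t + T) - θ t) 0 t := fun t => by
      refine (((hθ (t + T)).comp_add_const t T).sub (hθ t)).congr_deriv ?_
      rw [hωper, sub_self]
    intro t
    have h0 := is_const_of_deriv_eq_zero (fun t => (hd t).differentiableAt)
      (fun t => (hd t).deriv) t 0
    have : θ 0 = 0 := intervalIntegral.integral_same
    simp only [zero_add, hθT, this] at h0
    linarith
  have hθsurj : Function.Surjective θ :=
    surjective_of_add_eq_add (continuous_iff_continuousAt.2 fun t => (hθ t).continuousAt)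
      (by positivity) hθadd
  -- inverse radius `u` and its derivative `w` with respect to the polar angle
  set u : ℝ → ℝ := fun t => ‖x t‖⁻¹ with hu_def
  set w : ℝ → ℝ := fun t => -(((x t).re * (momentum m c (deriv x t)).re +
        (x t).im * (momentum m c (deriv x t)).im) / ‖x t‖ / L) with hw_def
  have hupos : ∀ t, 0 < u t := fun t => inv_pos.2 (hxpos t)
  have hMu : ∀ t, c ^ 2 * relMass m c x t = H + α * u t := fun t => by rw [← hH t]; ring
  have hu : ∀ t, HasDerivAt u (w t * ω t) t := fun t => by
    refine (hF.hasDerivAt_inv_r t).congr_deriv ?_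
    have := hMpos t; have := hxpos t
    simp only [hw_def, hω]
    field_simp
  have hw : ∀ t, HasDerivAt w
      (ω t * (α * H / (c ^ 2 * L ^ 2) - (1 - α ^ 2 / (c ^ 2 * L ^ 2)) * u t)) t := fun t => by
    refine (((hF.hasDerivAt_radialMomentum t).div_const L).neg).congr_deriv ?_
    have := hMpos t; have := hxpos t
    have hH' : H = c ^ 2 * relMass m c x t - α * ‖x t‖⁻¹ := (hH t).symm
    simp only [hL, hω, hu_def]
    rw [hH']
    field_simp
    ring
  have huper : Function.Periodic u T := fun t => by simp only [hu_def, hper t]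
  have hwper : Function.Periodic w T := fun t => by simp only [hw_def, hper t, hpper t]
  have hu_nc : ¬ ∀ s t, u s = u t := fun hc => hnc ⟨‖x 0‖, fun t => inv_injective (hc t 0)⟩
  have hKpos : 0 < 1 - α ^ 2 / (c ^ 2 * L ^ 2) := by
    by_contra hK
    exact hu_nc (const_of_nonpos hT (not_lt.1 hK) hωpos hu hw huper hwper)
  obtain ⟨κ, hκ, hκ2⟩ : ∃ κ : ℝ, 0 < κ ∧ κ ^ 2 = 1 - α ^ 2 / (c ^ 2 * L ^ 2) :=
    ⟨√(1 - α ^ 2 / (c ^ 2 * L ^ 2)), Real.sqrt_pos.2 hKpos, Real.sq_sqrt hKpos.le⟩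
  have hκ1 : κ < 1 := by
    have : 0 < α ^ 2 / (c ^ 2 * L ^ 2) := by positivity
    nlinarith
  obtain ⟨A, hA⟩ : ∃ A, κ ^ 2 * A = α * H / (c ^ 2 * L ^ 2) :=
    ⟨α * H / (c ^ 2 * L ^ 2) / κ ^ 2, by field_simp⟩
  rw [← hκ2, ← hA] at hw
  -- the pericenter
  obtain ⟨t₀, ht₀⟩ := exists_forall_le_of_periodic hT
    (continuous_iff_continuousAt.2 fun t => (hu t).continuousAt) huper
  have hw0 : w t₀ = 0 := by
    have : IsLocalMax u t₀ := Filter.Eventually.of_forall ht₀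
    exact (mul_eq_zero.1 (this.hasDerivAt_eq_zero (hu t₀))).resolve_right (hωpos t₀).ne'
  have hcos := eq_cos_of_pos hκ hu hw hθ hw0
  obtain ⟨B, hB⟩ : ∃ B, B = u t₀ - A := ⟨_, rfl⟩
  rw [← hB] at hcos
  -- an apocenter, which exists because the polar angle takes all real values
  obtain ⟨t₁, ht₁⟩ := hθsurj (θ t₀ + Real.pi / κ)
  have hu1 : u t₁ = A - B := by
    rw [hcos, ht₁, add_sub_cancel_left, mul_div_cancel₀ _ hκ.ne', Real.cos_pi]; ring
  have hu0 : u t₀ = A + B := by linarith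
  have hB0 : 0 < B := by
    have h1 := ht₀ t₁
    rcases eq_or_ne B 0 with h0 | h0
    · refine absurd (fun s t => ?_) hu_nc
      rw [hcos s, hcos t, h0, zero_mul, zero_mul]
    · exact lt_of_le_of_ne (by linarith) h0.symm
  have hBA : B < A := by have := hupos t₁; linarith
  have hE : (H + α * (A + B)) ^ 2 = m ^ 2 * c ^ 4 + c ^ 2 * L ^ 2 * (A + B) ^ 2 := by
    have h1 := hF.M_sq t₀
    have h2 := hMu t₀
    have h3 := hL t₀
    have h4 := hF.r_sq t₀
    have hr := hxpos t₀
    have h5 : (x t₀).re * (momentum m c (deriv x t₀)).re +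
        (x t₀).im * (momentum m c (deriv x t₀)).im = 0 := by
      have h6 := hw0
      simp only [hw_def, neg_eq_zero, div_eq_zero_iff] at h6
      -- the radial momentum vanishes at the pericenter
      rcases h6 with (h6 | h6) | h6
      · exact h6
      · exact absurd h6 hr.ne'
      · exact absurd h6 hLpos.ne'
    have h7 : (momentum m c (deriv x t₀)).re ^ 2 + (momentum m c (deriv x t₀)).im ^ 2 =
        L ^ 2 * u t₀ ^ 2 := by
      simp only [hu_def]
      rw [inv_pow, ← div_eq_mul_inv, eq_div_iff (pow_pos hr 2).ne', h4, ← h3]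
      linear_combination ((x t₀).re * (momentum m c (deriv x t₀)).re +
        (x t₀).im * (momentum m c (deriv x t₀)).im) * h5
    rw [← hu0, ← h2]
    rw [h7] at h1
    linear_combination c ^ 2 * h1
  obtain ⟨had, hLe, hHe, hAe⟩ := eq_parameters hm hc hα hκ hκ1 hLpos hB0 hBA hκ2 hA hE
  have hA0 : 0 < A := hB0.trans hBA
  have hU : ∀ s, invRadius m c α κ (B / A) (θ (t₀ + s) - θ t₀) = u (t₀ + s) := fun s => by
    unfold invRadius
    rw [hAe, hcos]
    field_simp
  -- the frequency ratio is rational, since the radius is a function of the angle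
  obtain ⟨j, hj⟩ : ∃ j : ℤ, (j : ℝ) * (2 * Real.pi) = κ * (k * (2 * Real.pi)) := by
    refine (Real.cos_eq_one_iff _).1 ?_
    have h1 := hcos (t₀ + T)
    rw [huper t₀, hu0, hθadd, add_sub_cancel_left] at h1
    have h2 : B * Real.cos (κ * (k * (2 * Real.pi))) = B * 1 := by linarith
    exact mul_left_cancel₀ hB0.ne' h2
  have hjκ : (j : ℝ) = κ * k := by
    have : (2 * Real.pi) ≠ 0 := by positivity
    exact mul_right_cancel₀ this (by rw [hj]; ring)
  have hj0 : 0 < j := by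
    have : (0 : ℝ) < j := by rw [hjκ]; positivity
    exact_mod_cast this
  obtain ⟨n, rfl⟩ := Int.eq_ofNat_of_zero_le hj0.le
  simp only [Int.cast_natCast] at hjκ
  have hκn : κ = n / k := by rw [hjκ]; field_simp
  have hn1 : 1 ≤ n := by omega
  have hnk : n < k := by
    have : (n : ℝ) < k := by rw [hjκ]; nlinarith
    exact_mod_cast this
  rw [hκn] at had hU hLe hHe
  -- time elapsed since the pericenter
  have hclock : ∀ s, clock m c α (n / k) (B / A) (θ (t₀ + s) - θ t₀) = s := by
    have hd : ∀ s, HasDerivAt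
        (fun s => clock m c α (n / k) (B / A) (θ (t₀ + s) - θ t₀) - s) 0 s := fun s => by
      have h1 : HasDerivAt (fun s => θ (t₀ + s) - θ t₀) (ω (t₀ + s)) s :=
        ((hθ (t₀ + s)).comp_const_add t₀ s).sub_const _
      refine (((had.hasDerivAt_clock _).comp s h1).sub (hasDerivAt_id s)).congr_deriv ?_
      rw [hU, hLe, hHe, ← hMu]
      have := hMpos (t₀ + s); have := hxpos (t₀ + s)
      simp only [hu_def, hω]
      field_simp
      ring
    intro s
    have h0 := is_const_of_deriv_eq_zero (fun t => (hd t).differentiableAt)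
      (fun t => (hd t).deriv) s 0
    simp only [add_zero, sub_self, Admissible.clock_zero] at h0
    linarith
  have hangle : ∀ s, orbitAngle m c α (n / k) (B / A) s = θ (t₀ + s) - θ t₀ := fun s => by
    conv_lhs => rw [← hclock s]
    exact had.orbitAngle_clock _
  -- `u e^{-iθ} x` is a constant of modulus one
  obtain ⟨φ, hφ⟩ : ∃ φ : ℝ, ∀ t, x t = ((u t)⁻¹ : ℝ) *
      Complex.exp (φ * Complex.I + θ t * Complex.I) := by
    have hd : ∀ t, HasDerivAt (fun t => (u t : ℂ) * x t * Complex.exp (-(θ t * Complex.I))) 0 t :=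
      fun t => by
        refine (((hu t).ofReal_comp.mul (hlog t)).mul
          (((hθ t).ofReal_comp.mul_const Complex.I).neg.cexp)).congr_deriv ?_
        have h1 : w t * ω t = -(u t * (((x t).re * (momentum m c (deriv x t)).re +
            (x t).im * (momentum m c (deriv x t)).im) / (relMass m c x t * ‖x t‖ ^ 2))) := by
          have := hMpos t; have := hxpos t
          simp only [hw_def, hω, hu_def]
          field_simp
        rw [h1]
        simp only [hω]
        push_cast
        simp only [Pi.mul_apply]
        ring
    have hconst := is_const_of_deriv_eq_zero (fun t => (hd t).differentiableAt)
      (fun t => (hd t).deriv)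
    have hnorm : ‖(u 0 : ℂ) * x 0 * Complex.exp (-(θ 0 * Complex.I))‖ = 1 := by
      rw [← neg_mul, ← Complex.ofReal_neg, norm_mul, Complex.norm_exp_ofReal_mul_I, mul_one,
        norm_mul, Complex.norm_real, Real.norm_of_nonneg (hupos 0).le]
      exact inv_mul_cancel₀ (hxpos 0).ne'
    refine ⟨Complex.arg ((u 0 : ℂ) * x 0 * Complex.exp (-(θ 0 * Complex.I))), fun t => ?_⟩
    have h1 := Complex.norm_mul_exp_arg_mul_I
      ((u 0 : ℂ) * x 0 * Complex.exp (-(θ 0 * Complex.I)))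
    rw [hnorm, Complex.ofReal_one, one_mul] at h1
    rw [Complex.exp_add, h1, ← hconst t 0]
    have h2 : Complex.exp (-(θ t * Complex.I)) * Complex.exp (θ t * Complex.I) = 1 := by
      rw [← Complex.exp_add, neg_add_cancel, Complex.exp_zero]
    have hu0 : (u t : ℂ) ≠ 0 := by exact_mod_cast (hupos t).ne'
    rw [mul_assoc _ (Complex.exp _) (Complex.exp _), h2]
    push_cast
    field_simp
  refine ⟨n, hn1, hnk, B / A, had, ?_, -t₀, φ + θ t₀, fun t => ?_⟩
  · have h1 := hclock T
    rw [hθadd, add_sub_cancel_left] at h1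
    have h2 := had.clock_add_nat_mul n 0
    have hn0 : (0 : ℝ) < n := by exact_mod_cast hn1
    have h3 : (0 : ℝ) + n * (2 * Real.pi / (n / k)) = k * (2 * Real.pi) := by field_simp; ring
    rw [h3, h1, Admissible.clock_zero, zero_add] at h2
    exact h2.symm
  · unfold orbit
    have e1 : t₀ + (t + -t₀) = t := by ring
    rw [hangle, hU, e1, hφ t]
    push_cast
    rw [mul_left_comm, ← Complex.exp_add]
    ring_nf

end RelKepler

/-! ### Radial periods and thresholds -/

namespace RelKepler

lemma Tstar_pos {m c α : ℝ} (hm : 0 < m) (hc : 0 < c) (hα : 0 < α) : 0 < Tstar m c α := by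
  have := Real.pi_pos
  unfold Tstar
  positivity

/-- The threshold `u^k_n` is `n` times the limit of the radial period for eccentricity zero. -/
lemma threshold_eq (m c α : ℝ) {k n : ℕ} (hnk : n < k) :
    threshold m c α k n =
      ((n * (Tstar m c α * (1 / √(1 - ((n : ℝ) / k) ^ 2)) ^ 3) : ℝ) : EReal) := by
  have hk0 : (0 : ℝ) < k := by exact_mod_cast (show 0 < k by omega)
  have hnk' : (n : ℝ) < k := by exact_mod_cast hnk
  have hn0 : (0 : ℝ) ≤ n := n.cast_nonneg
  have hpos : 0 < (k : ℝ) ^ 2 - (n : ℝ) ^ 2 := by nlinarith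
  have h1 : (1 - ((n : ℝ) / k) ^ 2) = ((k : ℝ) ^ 2 - (n : ℝ) ^ 2) / (k : ℝ) ^ 2 := by field_simp
  have h2 : ((k : ℝ) ^ 2 - (n : ℝ) ^ 2) ^ (3 / 2 : ℝ) = √((k : ℝ) ^ 2 - (n : ℝ) ^ 2) ^ 3 := by
    rw [Real.sqrt_eq_rpow, ← Real.rpow_mul_natCast hpos.le]
    norm_num
  unfold threshold
  rw [if_pos hnk, h1, h2, Real.sqrt_div hpos.le, Real.sqrt_sq hk0.le]
  have := Real.sqrt_pos.2 hpos
  congr 1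
  field_simp

lemma threshold_mono {m c α : ℝ} (hm : 0 < m) (hc : 0 < c) (hα : 0 < α) {k n n' : ℕ}
    (hnn : n ≤ n') (hnk : n' < k) : threshold m c α k n ≤ threshold m c α k n' := by
  rw [threshold_eq m c α (hnn.trans_lt hnk), threshold_eq m c α hnk, EReal.coe_le_coe_iff]
  have hT := Tstar_pos hm hc hα
  have hk0 : (0 : ℝ) < k := by exact_mod_cast (show 0 < k by omega)
  have hnk' : (n' : ℝ) / k < 1 := by rw [div_lt_one hk0]; exact_mod_cast hnk
  have h0 : 0 ≤ (n' : ℝ) / k := by positivity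
  have hpos : 0 < 1 - ((n' : ℝ) / k) ^ 2 := by nlinarith
  gcongr

namespace Admissible

variable {m c α κ e : ℝ}

lemma ratio_sq (h : Admissible m c α κ e) :
    (√(1 - e ^ 2 * (1 - κ ^ 2)) / (√(1 - e ^ 2) * √(1 - κ ^ 2))) ^ 2 =
      (1 - e ^ 2 * (1 - κ ^ 2)) / ((1 - e ^ 2) * (1 - κ ^ 2)) := by
  rw [div_pow, mul_pow, Real.sq_sqrt h.discr_pos.le, Real.sq_sqrt h.one_sub_e_sq_pos.le,
    Real.sq_sqrt h.one_sub_κ_sq_pos.le]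

lemma lt_radialPeriod (h : Admissible m c α κ e) :
    Tstar m c α * (1 / √(1 - κ ^ 2)) ^ 3 < radialPeriod m c α κ e := by
  have hT := Tstar_pos h.m_pos h.c_pos h.α_pos
  have h1 := Real.sqrt_pos.2 h.one_sub_e_sq_pos
  have h2 := Real.sqrt_pos.2 h.one_sub_κ_sq_pos
  have h3 : √(1 - e ^ 2) < √(1 - e ^ 2 * (1 - κ ^ 2)) := by
    refine Real.sqrt_lt_sqrt h.one_sub_e_sq_pos.le ?_
    nlinarith [mul_pos (pow_pos h.e_pos 2) (pow_pos h.κ_pos 2)]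
  unfold radialPeriod
  refine mul_lt_mul_of_pos_left (pow_lt_pow_left₀ ?_ (by positivity) three_ne_zero) hT
  rw [div_lt_div_iff₀ h2 (by positivity)]
  nlinarith

/-- Orbits with the same frequency ratio are distinguished by their radial periods. -/
lemma eq_of_radialPeriod_eq {e' : ℝ} (h : Admissible m c α κ e) (h' : Admissible m c α κ e')
    (heq : radialPeriod m c α κ e = radialPeriod m c α κ e') : e = e' := by
  have hT := Tstar_pos h.m_pos h.c_pos h.α_pos
  unfold radialPeriod at heq
  have h1 := (pow_left_inj₀ (by positivity) (by positivity) three_ne_zero).1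
    (mul_left_cancel₀ hT.ne' heq)
  have h2 := congrArg (· ^ 2) h1
  simp only [h.ratio_sq, h'.ratio_sq] at h2
  have := h.one_sub_e_sq_pos; have := h'.one_sub_e_sq_pos; have := h.one_sub_κ_sq_pos
  rw [div_eq_div_iff (by positivity) (by positivity)] at h2
  have h3 : (1 - κ ^ 2) * κ ^ 2 * (e ^ 2 - e' ^ 2) = 0 := by linear_combination h2
  have h4 : 0 < (1 - κ ^ 2) * κ ^ 2 := mul_pos this (pow_pos h.κ_pos 2)
  have h5 : e ^ 2 = e' ^ 2 := by
    have := (mul_eq_zero.1 h3).resolve_left h4.ne'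
    linarith
  exact (pow_left_inj₀ h.e_pos.le h'.e_pos.le two_ne_zero).1 h5

end Admissible

/-- Every value above the limit of small oscillations is a radial period. -/
lemma exists_radialPeriod_eq {m c α κ P : ℝ} (hm : 0 < m) (hc : 0 < c) (hα : 0 < α) (hκ : 0 < κ)
    (hκ1 : κ < 1) (hP : Tstar m c α * (1 / √(1 - κ ^ 2)) ^ 3 < P) :
    ∃ e, Admissible m c α κ e ∧ radialPeriod m c α κ e = P := by
  have hT := Tstar_pos hm hc hα
  have hl : 0 < 1 - κ ^ 2 := by nlinarith
  have hl' := Real.sqrt_pos.2 hl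
  have hP0 : 0 < P := lt_trans (by positivity) hP
  obtain ⟨q, hq0, hq⟩ : ∃ q : ℝ, 0 ≤ q ∧ q ^ 3 = P / Tstar m c α :=
    ⟨(P / Tstar m c α) ^ ((3 : ℕ) : ℝ)⁻¹, by positivity,
      Real.rpow_inv_natCast_pow (by positivity) three_ne_zero⟩
  have hq1 : 1 / √(1 - κ ^ 2) < q := by
    refine lt_of_pow_lt_pow_left₀ 3 hq0 ?_
    rw [hq, lt_div_iff₀ hT, mul_comm]
    exact hP
  have hq2 : 1 < q ^ 2 * (1 - κ ^ 2) := by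
    rw [div_lt_iff₀ hl'] at hq1
    rw [← Real.sq_sqrt hl.le, ← mul_pow]
    exact one_lt_pow₀ hq1 two_ne_zero
  -- solve `q² = (1 + κ² z) / (1 - κ²)` for `z = e² / (1 - e²)`
  obtain ⟨z, hz0, hz⟩ : ∃ z : ℝ, 0 < z ∧ q ^ 2 * (1 - κ ^ 2) = 1 + κ ^ 2 * z :=
    ⟨(q ^ 2 * (1 - κ ^ 2) - 1) / κ ^ 2, div_pos (by linarith) (by positivity), by field_simp; ring⟩
  have he2 : √(z / (1 + z)) ^ 2 = z / (1 + z) := Real.sq_sqrt (by positivity)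
  have had : Admissible m c α κ √(z / (1 + z)) :=
    ⟨hm, hc, hα, hκ, hκ1, Real.sqrt_pos.2 (by positivity), by
      rw [Real.sqrt_lt' one_pos, one_pow, div_lt_one (by positivity)]; linarith⟩
  refine ⟨_, had, ?_⟩
  have hr : √(1 - √(z / (1 + z)) ^ 2 * (1 - κ ^ 2)) /
      (√(1 - √(z / (1 + z)) ^ 2) * √(1 - κ ^ 2)) = q := by
    refine (pow_left_inj₀ (by positivity) hq0 two_ne_zero).1 ?_
    rw [had.ratio_sq]
    have h1 : 1 - √(z / (1 + z)) ^ 2 = 1 / (1 + z) := by rw [he2]; field_simp; ring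
    have h2 : 1 - √(z / (1 + z)) ^ 2 * (1 - κ ^ 2) = (1 + κ ^ 2 * z) / (1 + z) := by
      rw [he2]; field_simp; ring
    rw [h1, h2, ← hz]
    field_simp
  unfold radialPeriod
  rw [hr, hq]
  field_simp

/-! ### Counting the solutions -/

lemma isMinimalPeriod_norm_of_motion {x y : ℝ → ℂ} {τ : ℝ} (h : motionSetoid.r x y)
    (hx : IsMinimalPeriod (fun t => ‖x t‖) τ) : IsMinimalPeriod (fun t => ‖y t‖) τ := by
  obtain ⟨s, φ, h⟩ := h
  have hn : ∀ t, ‖y t‖ = ‖x (t + s)‖ := fun t => by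
    rw [h, norm_mul, Complex.norm_exp_ofReal_mul_I, one_mul]
  have hper : ∀ σ, Function.Periodic (fun t => ‖y t‖) σ ↔ Function.Periodic (fun t => ‖x t‖) σ := by
    refine fun σ => ⟨fun hp t => ?_, fun hp t => ?_⟩
    · have := hp (t - s)
      simp only [hn] at this
      rwa [sub_add_cancel, show t - s + σ + s = t + σ by ring] at this
    · simp only [hn]
      rw [show t + σ + s = t + s + σ by ring]
      exact hp (t + s)
  unfold IsMinimalPeriod
  simp only [hper]
  exact hx

/-- The number of radial periods in the time `T` is determined by the minimal period of `|x|`. -/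
lemma eq_of_isMinimalPeriod {f : ℝ → ℝ} {T : ℝ} {n n' : ℕ} (hT : 0 < T)
    (h : IsMinimalPeriod f (T / n)) (h' : IsMinimalPeriod f (T / n')) : n = n' := by
  have h1 : T * (n : ℝ)⁻¹ = T * (n' : ℝ)⁻¹ := by
    rw [← div_eq_mul_inv, ← div_eq_mul_inv]
    exact IsLeast.unique h h'
  exact_mod_cast inv_injective (mul_left_cancel₀ hT.ne' h1)

/-- A non-circular solution is equivalent to a rosette orbit whose threshold lies below `T`. -/
lemma exists_type_of_mem_nonCircular {m c α T : ℝ} (hm : 0 < m) (hc : 0 < c) (hα : 0 < α)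
    (hT : 0 < T) {k : ℕ} (hk : 1 ≤ k) {x : ℝ → ℂ} (hx : x ∈ nonCircular m c α T k) :
    ∃ n : ℕ, 1 ≤ n ∧ n < k ∧ threshold m c α k n < T ∧ IsOfType m c α T n k x ∧
      ∃ e, Admissible m c α (n / k) e ∧ n * radialPeriod m c α (n / k) e = T ∧
        motionSetoid.r (orbit m c α (n / k) e) x := by
  obtain ⟨n, hn, hnk, e, had, hP, hr⟩ := exists_orbit_of_mem_nonCircular hm hc hα hT hk hx
  have ht := isOfType_orbit hn hnk had hP
  refine ⟨n, hn, hnk, ?_, ⟨ht.1, ht.2.1, hx, isMinimalPeriod_norm_of_motion hr ht.2.2.2⟩,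
    e, had, hP, hr⟩
  rw [threshold_eq m c α hnk, EReal.coe_lt_coe_iff, ← hP]
  exact mul_lt_mul_of_pos_left had.lt_radialPeriod (by exact_mod_cast hn)

/-- Above its threshold there is exactly one solution of type `(n, k)` up to motions. -/
lemma exists_unique_type {m c α T : ℝ} (hm : 0 < m) (hc : 0 < c) (hα : 0 < α) (hT : 0 < T)
    {k n : ℕ} (hn : 1 ≤ n) (hnk : n < k) (ht : threshold m c α k n < T) :
    ∃ x, IsOfType m c α T n k x ∧ ∀ y, IsOfType m c α T n k y → motionSetoid.r x y := by
  have hk0 : (0 : ℝ) < k := by exact_mod_cast (show 0 < k by omega)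
  have hn0 : (0 : ℝ) < n := by exact_mod_cast hn
  have hκ1 : (n : ℝ) / k < 1 := by rw [div_lt_one hk0]; exact_mod_cast hnk
  rw [threshold_eq m c α hnk, EReal.coe_lt_coe_iff] at ht
  obtain ⟨e, had, hP⟩ := exists_radialPeriod_eq (P := T / n) hm hc hα (div_pos hn0 hk0) hκ1
    (by rw [lt_div_iff₀ hn0]; linarith)
  have hP' : n * radialPeriod m c α (n / k) e = T := by rw [hP]; field_simp
  refine ⟨_, isOfType_orbit hn hnk had hP', fun y hy => ?_⟩
  obtain ⟨n', -, -, -, hy', e', had', hPe, hr⟩ :=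
    exists_type_of_mem_nonCircular hm hc hα hT (by omega) hy.2.2.1
  obtain rfl := eq_of_isMinimalPeriod hT hy.2.2.2 hy'.2.2.2
  rwa [had.eq_of_radialPeriod_eq had' (mul_left_cancel₀ hn0.ne' (hP'.trans hPe.symm))]

end RelKepler

theorem mainTheorem5 (m c α : ℝ) (hm : 0 < m) (hc : 0 < c) (hα : 0 < α) :
    (∀ (T : ℝ) (k i : ℕ), 0 < T → 2 ≤ k → i ≤ k - 1 →
      RelKepler.threshold m c α k i < (T : EReal) →
      (T : EReal) ≤ RelKepler.threshold m c α k (i + 1) →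
      (i = 0 → RelKepler.nonCircular m c α T k = ∅) ∧
      (0 < i →
        -- up to time translations and rotations there are exactly `i` such solutions
        (Quotient.mk RelKepler.motionSetoid '' RelKepler.nonCircular m c α T k).encard = i ∧
        -- they are of types `(1, k), …, (i, k)`, one of each type
        (∀ x ∈ RelKepler.nonCircular m c α T k,
          ∃ n ∈ Set.Icc 1 i, RelKepler.IsOfType m c α T n k x) ∧
        (∀ n ∈ Set.Icc 1 i, ∃ x, RelKepler.IsOfType m c α T n k x ∧
          ∀ y, RelKepler.IsOfType m c α T n k y → RelKepler.motionSetoid.r x y))) ∧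
    (∀ T : ℝ, 0 < T → RelKepler.nonCircular m c α T 1 = ∅) := by
  refine ⟨fun T k i hT hk hik hlt hle => ?_, fun T hT => ?_⟩
  · have htype : ∀ x ∈ RelKepler.nonCircular m c α T k,
        ∃ n ∈ Set.Icc 1 i, RelKepler.IsOfType m c α T n k x := by
      intro x hx
      obtain ⟨n, hn, hnk, hnt, hx', -⟩ :=
        RelKepler.exists_type_of_mem_nonCircular hm hc hα hT (by omega) hx
      refine ⟨n, ⟨hn, ?_⟩, hx'⟩
      by_contra hni
      exact absurd (hnt.trans_le (hle.trans (RelKepler.threshold_mono hm hc hα (by omega) hnk)))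
        (lt_irrefl _)
    have huniq : ∀ n ∈ Set.Icc 1 i, ∃ x, RelKepler.IsOfType m c α T n k x ∧
        ∀ y, RelKepler.IsOfType m c α T n k y → RelKepler.motionSetoid.r x y := fun n hn =>
      RelKepler.exists_unique_type hm hc hα hT hn.1 (by have := hn.2; omega)
        ((RelKepler.threshold_mono hm hc hα hn.2 (by omega)).trans_lt hlt)
    refine ⟨fun hi => ?_, fun _ => ⟨?_, htype, huniq⟩⟩
    · refine Set.eq_empty_of_forall_notMem fun x hx => ?_
      obtain ⟨n, ⟨h1, h2⟩, -⟩ := htype x hx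
      omega
    · choose! o ho huo using huniq
      have himage : Quotient.mk RelKepler.motionSetoid '' RelKepler.nonCircular m c α T k =
          (fun n => Quotient.mk RelKepler.motionSetoid (o n)) '' Set.Icc 1 i := by
        ext q
        constructor
        · rintro ⟨x, hx, rfl⟩
          obtain ⟨n, hn, hxn⟩ := htype x hx
          exact ⟨n, hn, Quotient.sound (huo n hn x hxn)⟩
        · rintro ⟨n, hn, rfl⟩
          exact ⟨o n, (ho n hn).2.2.1, rfl⟩
      rw [himage, Set.InjOn.encard_image]
      · rw [← Finset.coe_Icc, Set.encard_coe_eq_coe_finsetCard, Nat.card_Icc, Nat.add_sub_cancel]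
      · intro n hn n' hn' heq
        have hr : RelKepler.motionSetoid.r (o n) (o n') := Quotient.exact heq
        exact RelKepler.eq_of_isMinimalPeriod hT
          (RelKepler.isMinimalPeriod_norm_of_motion hr (ho n hn).2.2.2) (ho n' hn').2.2.2
  · refine Set.eq_empty_of_forall_notMem fun x hx => ?_
    obtain ⟨n, hn, hn', -⟩ := RelKepler.exists_type_of_mem_nonCircular (k := 1) hm hc hα hT le_rfl
      (by exact_mod_cast hx)
    omega
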